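/- Let $A$ be a finite-dimensional algebra over a field $k$ which is symmetric, i.e. $A\cong\operatorname{Hom}_k(A,k)$ as $A$-bimodules. Modules are right modules. $\mathsf K(A)$ is the homotopy category of cochain complexes of $A$-modules, $\mathsf K^{b}(\mathrm{proj}A)\subseteq\mathsf K(A)$ the full subcategory of objects isomorphic to bounded complexes of finitely generated projective modules, and Hom denotes morphisms in $\mathsf K(A)$. A complex $P\in\mathsf K^{b}(\mathrm{proj}A)$ is partial tilting if $\operatorname{Hom}(P,P[i])=0$ for all $i\neq0$; it is tilting if moreover the smallest triangulated subcategory of $\mathsf K(A)$ that contains $P$ and is closed under direct summands contains $\mathsf K^{b}(\mathrm{proj}A)$. By $\operatorname{add}P$ we denote the class of direct summands of finite direct sums of copies of $P$. Let $P\in\mathsf K^{b}(\mathrm{proj}A)$ be a partial tilting complex of length $r+1$, that is, for some integers $s$ and $r\ge0$ the largest $i$ with $H^i(P)\ne0$ is $s$ and the smallest one is $s-r$. Construct a sequence $\Delta_n=\Delta_n(P,A)$, $n\ge0$, as follows: $\Delta_0=A$ (in degree $0$), and for $n\ge1$ choose $P_n\in\operatorname{add}P$ and a morphism $g'_n:P_n\to\Delta_{n-1}[r-s-n+1]$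 such that $\operatorname{Hom}(P,g'_n):\operatorname{Hom}(P,P_n)\to\operatorname{Hom}(P,\Delta_{n-1}[r-s-n+1])$ is a projective cover of right $\operatorname{End}(P)$-modules (so $P_n=0$ if the target is $0$), and let $\Delta_n$ be a cone of $g'_n[n+s-r-1]$, so that there is a distinguished triangle $$P_n[n+s-r-1]\xrightarrow{\,g'_n[n+s-r-1]\,}\Delta_{n-1}\to\Delta_n\to P_n[n+s-r].$$ Put $\Theta_n(P,A)=\Delta_n(P,A)\oplus P[n+s-r]$. Theorem. Such a sequence exists, and for every such sequence the following are equivalent: (1) $H^i(\Delta_r(P,A))=0$ for all $i>0$; (2) $\Theta_n(P,A)$ is a tilting complex for every $n\ge r$. -/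

import Mathlib

open CategoryTheory CategoryTheory.Limits CategoryTheory.Pretriangulated

universe v u w

/-- A surjection `f : Q → M` of `R`-modules with `Q` projective and with superfluous kernel. -/
structure IsProjectiveCover {R : Type*} {Q M : Type*} [Ring R] [AddCommGroup Q] [Module R Q]
    [AddCommGroup M] [Module R M] (f : Q →ₗ[R] M) : Prop where
  projective : Module.Projective R Q
  surjective : Function.Surjective f
  superfluous : ∀ N : Submodule R Q, N ⊔ LinearMap.ker f = ⊤ → N = ⊤

section Triangulated

variable {C : Type u} [Category.{v} C] [Preadditive C] [HasZeroObject C]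

/-- `X` belongs to `add P`: it is a direct summand of a finite direct sum of copies of `P`. -/
def InAdd [HasFiniteBiproducts C] (P X : C) : Prop :=
  ∃ n : ℕ, Nonempty (Retract X (⨁ fun _ : Fin n => P))

variable [HasShift C ℤ] [∀ n : ℤ, (shiftFunctor C n).Additive] [Pretriangulated C]

/-- One step of the construction of the complexes `Δ`: there are `Q` in `add P` and
`g' : Q ⟶ X[-m]` such that `Hom(P, g') : Hom(P, Q) ⟶ Hom(P, X[-m])` is a projective cover of
right `End(P)`-modules, and a distinguished triangle `Q[m] ⟶ X ⟶ Y ⟶ Q[m+1]` whose first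
morphism is `g'[m]`. If `Hom(P, X[-m]) = 0`, the condition on `g'` says precisely that `Q = 0`.
Recall that in Mathlib the product of `End P` is composition of maps, `f * g = g ≫ f`, and that
`preadditiveCoyonedaObj P` is the functor `Hom(P, -)` to right `End P`-modules. -/
def IsDeltaStep [HasFiniteBiproducts C] (P : C) (m : ℤ) (X Y : C) : Prop :=
  ∃ (Q : C) (g' : Q ⟶ X⟦-m⟧) (h : X ⟶ Y) (δ : Y ⟶ Q⟦m⟧⟦(1 : ℤ)⟧),
    InAdd P Q ∧
    IsProjectiveCover ((preadditiveCoyonedaObj P).map g').hom ∧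
    Triangle.mk (g'⟦m⟧' ≫ (shiftFunctorCompIsoId C (-m) m (neg_add_cancel m)).hom.app X) h δ
      ∈ distTriang C

/-- `Δ₀, Δ₁, Δ₂, …` is a family obtained from `M` by the iterated construction: `Δ₀` is `M`, and
for `n ≥ 1` the object `Δₙ` is a cone of `Pₙ[n+s-r-1] ⟶ Δₙ₋₁`. (The index is shifted by one
below.) -/
def IsDeltaFamily [HasFiniteBiproducts C] (P M : C) (s : ℤ) (r : ℕ) (Δ : ℕ → C) : Prop :=
  Nonempty (Δ 0 ≅ M) ∧ ∀ n : ℕ, IsDeltaStep P (n + s - r) (Δ n) (Δ (n + 1))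

/-- `Hom(X, X[n]) = 0` for all `n ≠ 0`. -/
def IsSelfOrthogonal (X : C) : Prop :=
  ∀ n : ℤ, n ≠ 0 → ∀ f : X ⟶ X⟦n⟧, f = 0

/-- `Θₙ = Δₙ ⊕ P[n+s-r]`. -/
noncomputable def thetaObj [HasBinaryBiproducts C] (P : C) (s : ℤ) (r : ℕ) (Δ : ℕ → C) (n : ℕ) :
    C :=
  Δ n ⊞ P⟦(n + s - r : ℤ)⟧

end Triangulated

section Algebras

/-- The finite-dimensional algebra `A` is symmetric: `A` and `DA = Hom_k(A, k)` are isomorphic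
as `A`-bimodules, where `(a f b)(y) = f (b y a)` for `f` in `DA`. -/
def IsSymmetricAlg (k : Type w) (A : Type u) [Field k] [Ring A] [Algebra k A] : Prop :=
  ∃ φ : A ≃ₗ[k] (A →ₗ[k] k), ∀ a x b y : A, φ (a * x * b) y = φ x (b * y * a)

variable (A : Type u) [Ring A]

/-- The homotopy category `K(A)` of cochain complexes of right `A`-modules. -/
abbrev KMod : Type _ := HomotopyCategory (ModuleCat.{u} Aᵐᵒᵖ) (ComplexShape.up ℤ)

instance : HasFiniteBiproducts (KMod A) := HasFiniteBiproducts.of_hasFiniteProducts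

/-- The right regular module `A`, as a complex concentrated in degree zero. -/
noncomputable def regularComplex : KMod A :=
  (HomotopyCategory.singleFunctor (ModuleCat.{u} Aᵐᵒᵖ) 0).obj (ModuleCat.of Aᵐᵒᵖ A)

/-- The objects of `K^b(proj A)`: those of `K(A)` isomorphic to a bounded complex of finitely
generated projective right `A`-modules. -/
def KbProj : ObjectProperty (KMod A) := fun X =>
  ∃ K : CochainComplex (ModuleCat.{u} Aᵐᵒᵖ) ℤ,
    (∃ a b : ℤ, ∀ i : ℤ, (i < a ∨ b < i) → IsZero (K.X i)) ∧
    (∀ i : ℤ, Module.Finite Aᵐᵒᵖ (K.X i) ∧ Module.Projective Aᵐᵒᵖ (K.X i)) ∧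
    Nonempty (X ≅ (HomotopyCategory.quotient _ _).obj K)

variable {A}

/-- The cohomology module `H^i(X)`. -/
noncomputable def cohomology (X : KMod A) (i : ℤ) : ModuleCat.{u} Aᵐᵒᵖ :=
  (HomotopyCategory.homologyFunctor (ModuleCat.{u} Aᵐᵒᵖ) (ComplexShape.up ℤ) i).obj X

/-- `X` has length `r + 1`, with top cohomology in degree `s`: the largest degree of a nonzero
cohomology module is `s` and the smallest one is `s - r`. -/
def HasLengthWithTop (X : KMod A) (s : ℤ) (r : ℕ) : Prop :=
  IsGreatest {i : ℤ | ¬ IsZero (cohomology X i)} s ∧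
    IsLeast {i : ℤ | ¬ IsZero (cohomology X i)} (s - r)

/-- Partial tilting complexes (in `K^b(proj A)`, a full subcategory of both `K(A)` and `D(A)`). -/
def IsPartialTilting (X : KMod A) : Prop :=
  KbProj A X ∧ IsSelfOrthogonal X

/-- Tilting complexes: partial tilting complexes `T` that generate `K^b(proj A)`, which means
that `K^b(proj A)` is contained in the smallest triangulated subcategory that contains `T` and is
closed under direct summands. -/
def IsTilting (T : KMod A) : Prop :=
  IsPartialTilting T ∧ KbProj A ≤ (ObjectProperty.singleton T).triangEnvelope

end Algebras

/-! Generation by Θₙ is automatic: P and Δₙ are summands up to shift, and the triangles lead back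
from Δₙ to Δ₀ = A. So only self-orthogonality is at stake.

Symmetry of A enters through one fact: for X in K^b(proj A), Hom(X, Y) = 0 forces Hom(Y, X) = 0
(`IsSymmetricAlg.eq_zero_of_forall_eq_zero`). Since Hom(A, P[i]) = H^i(P), it confines the nonzero
groups Hom(P, A[i]) to -s ≤ i ≤ r - s. Each step kills the top degree of this range, so for n ≥ r
only Hom(P, Δₙ[r-s-n]) can survive (`IsDeltaFamily.homVanish`), and dually for Hom(Δₙ, P[i]). Hence
the mixed terms of Θₙ are harmless, and, by duality once more, Θₙ is tilting iff Hom(Δₙ, Δₙ[i]) = 0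
for i > 0.

For n = r, unwinding the first argument along the triangles turns this group into Hom(A, Δᵣ[i]) =
H^i(Δᵣ), as far as vanishing is concerned (`IsDeltaFamily.homVanish_self_iff`). The vanishing then
propagates from n to n + 1 (`IsDeltaFamily.homVanish_self_of_le`).

Existence of the sequence rests on finite dimension: projective covers over End(P) exist, and they
are realized in add P because idempotents split in K^b(proj A). -/

section HomVanish

/-! ### Vanishing of shifted Hom groups. -/

variable {C : Type u} [Category.{v} C] [Preadditive C] [HasShift C ℤ]

/-- `Hom(X, Y[n]) = 0`. -/
def HomVanish (X Y : C) (n : ℤ) : Prop := ∀ f : X ⟶ Y⟦n⟧, f = 0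

lemma HomVanish.of_iso_left {X X' Y : C} {n : ℤ} (e : X ≅ X') (h : HomVanish X Y n) :
    HomVanish X' Y n := fun f => by
  rw [← cancel_epi e.hom, h (e.hom ≫ f), comp_zero]

lemma HomVanish.of_retract_left {X X' Y : C} {n : ℤ} (e : Retract X' X) (h : HomVanish X Y n) :
    HomVanish X' Y n := fun f => by
  rw [← Category.id_comp f, ← e.retract, Category.assoc, h (e.r ≫ f), comp_zero]

lemma HomVanish.biprod_left [HasBinaryBiproducts C] {X X' Y : C} {n : ℤ} (h : HomVanish X Y n)
    (h' : HomVanish X' Y n) : HomVanish (X ⊞ X') Y n := fun f =>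
  biprod.hom_ext' _ _ (by rw [h (_ ≫ f), comp_zero]) (by rw [h' (_ ≫ f), comp_zero])

lemma HomVanish.biproduct_left [HasFiniteBiproducts C] {X Y : C} {n : ℤ} (h : HomVanish X Y n)
    (m : ℕ) : HomVanish (⨁ fun _ : Fin m => X) Y n := fun f =>
  biproduct.hom_ext' _ _ fun j => by rw [h (_ ≫ f), comp_zero]

lemma HomVanish.inAdd_left [HasFiniteBiproducts C] {X X' Y : C} {n : ℤ} (h : HomVanish X Y n)
    (hX' : InAdd X X') : HomVanish X' Y n := by
  obtain ⟨m, ⟨e⟩⟩ := hX'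
  exact (h.biproduct_left m).of_retract_left e

lemma homVanish_shift_left (X Y : C) (a n : ℤ) :
    HomVanish (X⟦a⟧) Y n ↔ HomVanish X Y (n - a) := by
  let e : Y⟦n - a⟧⟦a⟧ ≅ Y⟦n⟧ := ((shiftFunctorAdd' C (n - a) a n (by lia)).app Y).symm
  constructor
  · intro h f
    apply (shiftFunctor C a).map_injective
    rw [← cancel_mono e.hom, h (f⟦a⟧' ≫ e.hom), (shiftFunctor C a).map_zero, zero_comp]
  · intro h f
    obtain ⟨g, hg⟩ := (shiftFunctor C a).map_surjective (f ≫ e.inv)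
    rw [← cancel_mono e.inv, ← hg, h g, (shiftFunctor C a).map_zero, zero_comp]

lemma homVanish_shift_right (X Y : C) (a n : ℤ) :
    HomVanish X (Y⟦a⟧) n ↔ HomVanish X Y (a + n) := by
  let e : Y⟦a⟧⟦n⟧ ≅ Y⟦a + n⟧ := ((shiftFunctorAdd C a n).app Y).symm
  constructor
  · intro h f
    rw [← cancel_mono e.inv, h (f ≫ e.inv), zero_comp]
  · intro h f
    rw [← cancel_mono e.hom, h (f ≫ e.hom), zero_comp]

lemma HomVanish.of_iso_right {X Y Y' : C} {n : ℤ} (e : Y ≅ Y') (h : HomVanish X Y n) :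
    HomVanish X Y' n := fun f => by
  rw [← cancel_mono (e.inv⟦n⟧'), h (f ≫ _), zero_comp]

lemma HomVanish.of_retract_right {X Y Y' : C} {n : ℤ} (e : Retract Y' Y) (h : HomVanish X Y n) :
    HomVanish X Y' n := fun f => by
  rw [← Category.comp_id f, ← CategoryTheory.Functor.map_id, ← e.retract, Functor.map_comp,
    ← Category.assoc,
    h (f ≫ _), zero_comp]

variable [∀ n : ℤ, (shiftFunctor C n).Additive]

lemma HomVanish.biprod_right [HasBinaryBiproducts C] {X Y Y' : C} {n : ℤ} (h : HomVanish X Y n)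
    (h' : HomVanish X Y' n) : HomVanish X (Y ⊞ Y') n := fun f => by
  rw [← Category.comp_id f, ← CategoryTheory.Functor.map_id, ← biprod.total, Functor.map_add,
    Functor.map_comp,
    Functor.map_comp, Preadditive.comp_add, ← Category.assoc, ← Category.assoc, h (f ≫ _),
    h' (f ≫ _), zero_comp, zero_comp, add_zero]

lemma HomVanish.inAdd_right [HasFiniteBiproducts C] {X Y Y' : C} {n : ℤ} (h : HomVanish X Y n)
    (hY' : InAdd Y Y') : HomVanish X Y' n := by
  obtain ⟨m, ⟨e⟩⟩ := hY'
  refine HomVanish.of_retract_right e fun f => ?_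
  rw [← Category.comp_id f, ← CategoryTheory.Functor.map_id, ← biproduct.total, Functor.map_sum,
    Preadditive.comp_sum]
  refine Finset.sum_eq_zero fun j _ => ?_
  rw [Functor.map_comp, ← Category.assoc, h (f ≫ _), zero_comp]

variable [HasZeroObject C] [Pretriangulated C]

lemma HomVanish.triangle_left₁ {T : Triangle C} (hT : T ∈ distTriang C) {Y : C} {n : ℤ}
    (h₂ : HomVanish T.obj₂ Y n) (h₃ : HomVanish T.obj₃ Y (n + 1)) : HomVanish T.obj₁ Y n := by
  intro f
  have h₃' : HomVanish (T.obj₃⟦(-1 : ℤ)⟧) Y n := by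
    rw [homVanish_shift_left, sub_neg_eq_add]; exact h₃
  obtain ⟨g, rfl⟩ := Triangle.yoneda_exact₂ _ (inv_rot_of_distTriang _ hT) f (h₃' _)
  rw [h₂ g]
  exact comp_zero

lemma HomVanish.triangle_left₃ {T : Triangle C} (hT : T ∈ distTriang C) {Y : C} {n : ℤ}
    (h₁ : HomVanish T.obj₁ Y (n - 1)) (h₂ : HomVanish T.obj₂ Y n) : HomVanish T.obj₃ Y n := by
  intro f
  obtain ⟨g, rfl⟩ := Triangle.yoneda_exact₃ _ hT f (h₂ _)
  rw [(homVanish_shift_left _ _ _ _).2 h₁ g, comp_zero]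

lemma HomVanish.triangle_right₃ {T : Triangle C} (hT : T ∈ distTriang C) {X : C} {n : ℤ}
    (h₁ : HomVanish X T.obj₁ (n + 1)) (h₂ : HomVanish X T.obj₂ n) : HomVanish X T.obj₃ n := by
  intro f
  have h₁' : HomVanish X (T.obj₁⟦(1 : ℤ)⟧) n := by
    rw [homVanish_shift_right, add_comm]; exact h₁
  obtain ⟨g, rfl⟩ := Triangle.coyoneda_exact₂ _
    (Triangle.shift_distinguished _ (rot_of_distTriang _ hT) n) f (h₁' _)
  rw [h₂ g]
  exact zero_comp

end HomVanish

/-! ### Hom groups along the iterated construction. -/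

section DeltaFamily

variable {C : Type u} [Category.{v} C] [Preadditive C] [HasZeroObject C] [HasFiniteBiproducts C]
  [HasShift C ℤ] [∀ n : ℤ, (shiftFunctor C n).Additive] [Pretriangulated C]

/-- After one step of the construction, the group `Hom(P, X[-m])` is killed. -/
lemma IsDeltaStep.homVanish_neg {P X Y : C} {m : ℤ} (h : IsDeltaStep P m X Y)
    (hP : IsSelfOrthogonal P) : HomVanish P Y (-m) := by
  obtain ⟨Q, g', i, δ, hQ, hg, hT⟩ := h
  suffices H : HomVanish (P⟦m⟧) Y 0 by
    rwa [homVanish_shift_left, zero_sub] at H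
  suffices H : ∀ f : P⟦m⟧ ⟶ Y, f = 0 by
    intro f
    rw [← cancel_mono ((shiftFunctorZero C ℤ).hom.app Y), H (f ≫ _), zero_comp]
  intro f
  have hQ' : HomVanish (P⟦m⟧) (Q⟦m⟧) 1 := by
    rw [homVanish_shift_left, homVanish_shift_right]
    exact HomVanish.inAdd_right (fun f => hP _ (by lia) f) hQ
  -- Every map to the cone comes from `X`; by surjectivity of Hom(P, g') it then factors through
  -- `Q⟦m⟧`, so it dies in `Y`.
  obtain ⟨x, rfl⟩ : ∃ x : P⟦m⟧ ⟶ X, f = x ≫ i := Triangle.coyoneda_exact₃ _ hT f (hQ' _)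
  obtain ⟨y, hy⟩ := (shiftFunctor C m).map_surjective
    (x ≫ (shiftFunctorCompIsoId C (-m) m (neg_add_cancel m)).inv.app X)
  obtain ⟨z, hz⟩ : ∃ z : P ⟶ Q, z ≫ g' = y := hg.surjective y
  have hx : x = z⟦m⟧' ≫ g'⟦m⟧' ≫
      (shiftFunctorCompIsoId C (-m) m (neg_add_cancel m)).hom.app X := by
    rw [← Functor.map_comp_assoc, hz, hy]
    simp
  have h0 := comp_distTriang_mor_zero₁₂ _ hT
  rw [hx]
  exact (Category.assoc _ _ _).trans ((congrArg _ h0).trans comp_zero)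

variable {P M : C} {s : ℤ} {r : ℕ} {Δ : ℕ → C}

/-- Keeps what the long exact sequences need. The projective cover itself contributes to the
equivalence through `IsDeltaStep.homVanish_neg`. -/
lemma IsDeltaFamily.exists_triangle (hΔ : IsDeltaFamily P M s r Δ) (n : ℕ) :
    ∃ T ∈ distTriang C, ∃ Q, InAdd P Q ∧ T.obj₁ = Q⟦(n + s - r : ℤ)⟧ ∧ T.obj₂ = Δ n ∧
      T.obj₃ = Δ (n + 1) := by
  obtain ⟨Q, g', i, δ, hQ, hg, hT⟩ := hΔ.2 n
  exact ⟨_, hT, Q, hQ, rfl, rfl, rfl⟩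

lemma IsDeltaFamily.homVanish_succ_left (hΔ : IsDeltaFamily P M s r Δ) {Y : C} {n : ℕ} {i : ℤ}
    (h₁ : HomVanish P Y (i - 1 - (n + s - r))) (h₂ : HomVanish (Δ n) Y i) :
    HomVanish (Δ (n + 1)) Y i := by
  obtain ⟨T, hT, Q, hQ, e₁, e₂, e₃⟩ := hΔ.exists_triangle n
  rw [← e₃]
  refine HomVanish.triangle_left₃ hT ?_ (by rwa [e₂])
  rw [e₁, homVanish_shift_left]
  exact h₁.inAdd_left hQ

lemma IsDeltaFamily.homVanish_of_succ_left (hΔ : IsDeltaFamily P M s r Δ) {Y : C} {n : ℕ} {i : ℤ}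
    (h₁ : HomVanish P Y (i - (n + s - r))) (h₂ : HomVanish (Δ (n + 1)) Y i) :
    HomVanish (Δ n) Y i := by
  obtain ⟨T, hT, Q, hQ, e₁, e₂, e₃⟩ := hΔ.exists_triangle n
  rw [← e₂]
  have hT' := rot_of_distTriang _ hT
  refine HomVanish.triangle_left₁ hT' (show HomVanish T.obj₃ Y i by rwa [e₃]) ?_
  change HomVanish (T.obj₁⟦(1 : ℤ)⟧) Y (i + 1)
  rw [homVanish_shift_left, e₁, homVanish_shift_left]
  exact HomVanish.inAdd_left (by rwa [add_sub_cancel_right]) hQ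

lemma IsDeltaFamily.homVanish_succ_right (hΔ : IsDeltaFamily P M s r Δ) {X : C} {n : ℕ} {i : ℤ}
    (h₁ : HomVanish X P (n + s - r + (i + 1))) (h₂ : HomVanish X (Δ n) i) :
    HomVanish X (Δ (n + 1)) i := by
  obtain ⟨T, hT, Q, hQ, e₁, e₂, e₃⟩ := hΔ.exists_triangle n
  rw [← e₃]
  refine HomVanish.triangle_right₃ hT ?_ (by rwa [e₂])
  rw [e₁, homVanish_shift_right]
  exact h₁.inAdd_right hQ

/-- The vanishing of `Hom(P, Δₙ[i])` outside of the interval `-s ≤ i ≤ r - s - n`, for `n ≤ r`, or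
outside of `{r - s - n}`, for `n ≥ r`. -/
lemma IsDeltaFamily.homVanish (hΔ : IsDeltaFamily P M s r Δ) (hP : IsSelfOrthogonal P)
    (hM : ∀ i : ℤ, (i < -s ∨ r - s < i) → HomVanish P M i) (n : ℕ) (i : ℤ)
    (hi : (i < -s ∧ i < r - s - n) ∨ r - s - n < i) : HomVanish P (Δ n) i := by
  induction n generalizing i with
  | zero => exact (hM i (by grind)).of_iso_right hΔ.1.some.symm
  | succ n ih =>
    -- This is the degree killed by the step. The added term affects degree `r - s - n - 1` alone,
    -- which is the new upper bound.
    by_cases h : i = r - s - n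
    · have := (hΔ.2 n).homVanish_neg hP
      rwa [show -(n + s - r : ℤ) = i by lia] at this
    · push_cast at hi
      exact hΔ.homVanish_succ_right (fun f => hP _ (by lia) f) (ih i (by lia))

lemma IsDeltaFamily.homVanish_of_le (hΔ : IsDeltaFamily P M s r Δ) (hP : IsSelfOrthogonal P)
    (hM : ∀ i : ℤ, (i < -s ∨ r - s < i) → HomVanish P M i) {n : ℕ} (hn : r ≤ n) {i : ℤ}
    (hi : i ≠ r - s - n) : HomVanish P (Δ n) i :=
  hΔ.homVanish hP hM n i (by lia)

/-- `Hom(Δᵣ, Δᵣ[i])` vanishes for all `i > 0` if and only if `Hom(M, Δᵣ[i])` does. -/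
lemma IsDeltaFamily.homVanish_self_iff (hΔ : IsDeltaFamily P M s r Δ) (hP : IsSelfOrthogonal P)
    (hM : ∀ i : ℤ, (i < -s ∨ r - s < i) → HomVanish P M i) {i : ℤ} (hi : 0 < i) :
    HomVanish (Δ r) (Δ r) i ↔ HomVanish M (Δ r) i := by
  -- Hom(P, Δᵣ[j]) lives in `j = -s`. For `n < r` the error terms of the step from `n` to `n + 1`
  -- meet this degree when `i = n - r` or `i = n + 1 - r`, neither of which is positive.
  have key : ∀ n ≤ r, HomVanish (Δ n) (Δ r) i ↔ HomVanish M (Δ r) i := by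
    intro n
    induction n with
    | zero =>
      exact fun _ => ⟨fun h => h.of_iso_left hΔ.1.some, fun h => h.of_iso_left hΔ.1.some.symm⟩
    | succ n ih =>
      intro hn
      rw [← ih (by lia)]
      exact ⟨hΔ.homVanish_of_succ_left (hΔ.homVanish_of_le hP hM le_rfl (by lia)),
        hΔ.homVanish_succ_left (hΔ.homVanish_of_le hP hM le_rfl (by lia))⟩
  exact key r le_rfl

/-- Change the two arguments from `Δ n` to `Δ (n + 1)` one at a time: the error terms are
concentrated in `i = -1` and `i = 0`. The first one is a map into a shift of `P`, which is why
`hdual` is needed. -/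
lemma IsDeltaFamily.homVanish_self_of_le (hΔ : IsDeltaFamily P M s r Δ) (hP : IsSelfOrthogonal P)
    (hM : ∀ i : ℤ, (i < -s ∨ r - s < i) → HomVanish P M i)
    (hdual : ∀ (n : ℕ) (i : ℤ), HomVanish P (Δ n) i → HomVanish (Δ n) P (-i))
    (h : ∀ i : ℤ, 0 < i → HomVanish (Δ r) (Δ r) i) {n : ℕ} (hn : r ≤ n) :
    ∀ i : ℤ, 0 < i → HomVanish (Δ n) (Δ n) i := by
  induction n, hn using Nat.le_induction with
  | base => exact h
  | succ n hn ih =>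
    intro i hi
    refine hΔ.homVanish_succ_left ?_ (hΔ.homVanish_succ_right ?_ (ih i hi))
    · exact hΔ.homVanish_of_le hP hM (by lia) (by lia)
    · have := hdual n (-(n + s - r + (i + 1))) (hΔ.homVanish_of_le hP hM hn (by lia))
      rwa [neg_neg] at this

end DeltaFamily

section Theta

variable {C : Type u} [Category.{v} C] [Preadditive C] [HasBinaryBiproducts C]
  [HasShift C ℤ] [∀ n : ℤ, (shiftFunctor C n).Additive] {P : C} {s : ℤ} {r : ℕ} {Δ : ℕ → C}

lemma isSelfOrthogonal_thetaObj_iff (hP : IsSelfOrthogonal P) {n : ℕ}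
    (h : ∀ i ≠ 0, HomVanish P (Δ n) (r - s - n + i))
    (h' : ∀ i ≠ 0, HomVanish (Δ n) P (n + s - r + i)) :
    IsSelfOrthogonal (thetaObj P s r Δ n) ↔ IsSelfOrthogonal (Δ n) := by
  constructor
  · intro H i hi
    let e : Retract (Δ n) (thetaObj P s r Δ n) := ⟨biprod.inl, biprod.fst, biprod.inl_fst⟩
    exact HomVanish.of_retract_left e (HomVanish.of_retract_right e (H i hi))
  · intro H i hi
    refine HomVanish.biprod_left (HomVanish.biprod_right (H i hi) ?_) (HomVanish.biprod_right ?_ ?_)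
    · rw [homVanish_shift_right]
      exact h' i hi
    · rw [homVanish_shift_left]
      convert h i hi using 1
      lia
    · rw [homVanish_shift_left, homVanish_shift_right]
      exact fun f => hP _ (by lia) f

end Theta

/-! ### Duality for complexes from traces. -/

section PerfectTrace

open CochainComplex HomComplex

variable {k : Type w} [Field k] {C : Type u} [Category.{v} C] [Preadditive C] [Linear k C]

/-- A family of linear forms `t` on the endomorphisms of the objects satisfying `p`, with
`t (f ≫ g) = t (g ≫ f)`, such that the pairings `(f, g) ↦ t (f ≫ g)` identify `Hom(M, Q)` with the
dual of `Hom(Q, M)` if `Q` satisfies `p`. -/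
structure IsPerfectTrace (p : ObjectProperty C) (t : ∀ Q : C, (Q ⟶ Q) →ₗ[k] k) : Prop where
  comm {Q Q' : C} (hQ : p Q) (hQ' : p Q') (f : Q ⟶ Q') (g : Q' ⟶ Q) : t Q (f ≫ g) = t Q' (g ≫ f)
  eq_zero {Q M : C} (hQ : p Q) (g : M ⟶ Q) (hg : ∀ f : Q ⟶ M, t Q (f ≫ g) = 0) : g = 0
  exists_eq {Q M : C} (hQ : p Q) (ψ : (Q ⟶ M) →ₗ[k] k) : ∃ g : M ⟶ Q, ∀ f, ψ f = t Q (f ≫ g)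

variable {p : ObjectProperty C} {t : ∀ Q : C, (Q ⟶ Q) →ₗ[k] k}

/-- `HomComplex.Cochain.single` as a linear map. -/
def singleLinearMap (k : Type w) [Field k] {C : Type u} [Category.{v} C] [Preadditive C]
    [Linear k C] (X Y : CochainComplex C ℤ) (i j n : ℤ) : (X.X i ⟶ Y.X j) →ₗ[k] Cochain X Y n where
  toFun f := Cochain.single f n
  map_add' f g := by
    ext a b hab
    simp only [Cochain.single, Cochain.mk_v, Cochain.add_v]
    split_ifs <;> simp
  map_smul' c f := by
    ext a b hab
    simp only [Cochain.single, Cochain.mk_v, Cochain.smul_v, RingHom.id_apply]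
    split_ifs <;> simp

namespace IsPerfectTrace

variable {X Y : CochainComplex C ℤ}

/-- The signed sum of the traces of the components of `δ z ≫ g` is zero. -/
lemma sum_trace_δ_eq_zero (ht : IsPerfectTrace p t) (hX : ∀ i, p (X.X i)) (a : ℤ) (N : ℕ)
    (ha : IsZero (X.X (a - 1)))
    (hN : IsZero (X.X (a + N))) (g : Y ⟶ X) (z : Cochain X Y (-1)) :
    ∑ j ∈ Finset.range N, t _ ((δ (-1) 0 z).v (a + j) (a + j) (add_zero _) ≫
      ((a + j).negOnePow • g.f (a + j))) = 0 := by
  -- The two terms of `δ z` become `y i` and `-y (i + 1)` once the differential is moved past `g`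
  -- and around the trace, so the sum telescopes.
  let y : ℤ → k := fun i => t (X.X (i - 1))
    (X.d (i - 1) i ≫ z.v i (i - 1) rfl ≫ (i.negOnePow • g.f (i - 1)))
  have hy : ∀ i, t _ ((δ (-1) 0 z).v i i (add_zero _) ≫ (i.negOnePow • g.f i)) =
      y i - y (i + 1) := by
    intro i
    rw [δ_v (-1) 0 (by lia) z i i (add_zero i) (i - 1) (i + 1) (by lia) (by lia),
      Preadditive.add_comp, map_add, sub_eq_add_neg (y i)]
    congr 1
    · dsimp only [y]
      refine Eq.trans ?_ ((ht.comm (hX _) (hX _) (z.v i (i - 1) rfl ≫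
        (i.negOnePow • g.f (i - 1))) (X.d (i - 1) i)))
      simp
    · dsimp only [y]
      have e : ∀ (i' : ℤ) (h : i' = i) (h₁ : i + 1 + (-1) = i'),
          t _ (((0 : ℤ).negOnePow • X.d i (i + 1) ≫ z.v (i + 1) i (by lia)) ≫
            (i.negOnePow • g.f i)) =
          -t (X.X i') (X.d i' (i + 1) ≫ z.v (i + 1) i' h₁ ≫
            ((i + 1).negOnePow • g.f i')) := by
        rintro _ rfl _
        simp [Int.negOnePow_succ]
      exact e _ (by lia) _
  simp only [hy]
  have := Finset.sum_range_sub' (fun j : ℕ => y (a + j)) N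
  push_cast at this
  simp only [← add_assoc] at this
  rw [this, add_zero]
  have h₁ : y a = 0 := by
    dsimp only [y]
    rw [ha.eq_of_src (X.d (a - 1) a) 0, zero_comp, map_zero]
  have h₂ : y (a + N) = 0 := by
    dsimp only [y]
    rw [hN.eq_of_tgt (X.d (a + N - 1) (a + N)) 0, zero_comp, map_zero]
  rw [h₁, h₂, sub_zero]

/-- If `X` is bounded with terms in `p`, and all morphisms `X ⟶ Y` are homotopic to zero, then so
are all morphisms `Y ⟶ X`. -/
theorem nonempty_homotopy_zero (ht : IsPerfectTrace p t) (hX : ∀ i, p (X.X i)) (a : ℤ) (N : ℕ)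
    (hbd : ∀ i, (i < a ∨ a + N ≤ i) → IsZero (X.X i))
    (h : ∀ f : X ⟶ Y, Nonempty (Homotopy f 0)) (g : Y ⟶ X) : Nonempty (Homotopy g 0) := by
  -- The signed supertrace of `f ≫ g`. It kills coboundaries, hence all cocycles by `h`, so it
  -- factors through the differential as `ψ ∘ δ`; the components of `ψ` are represented by maps `s i
  -- j`, which form the homotopy up to sign.
  let L : Cochain X Y 0 →ₗ[k] k :=
    { toFun f := ∑ j ∈ Finset.range N, t _ (f.v (a + j) (a + j) (add_zero _) ≫
        ((a + j).negOnePow • g.f (a + j)))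
      map_add' f f' := by simp [Finset.sum_add_distrib]
      map_smul' c f := by simp [Finset.mul_sum, mul_smul_comm] }
  have hL : L ∈ (LinearMap.ker (δ_hom k X Y 0 1)).dualAnnihilator := by
    rw [Submodule.mem_dualAnnihilator]
    intro f hf
    obtain ⟨f, rfl⟩ : ∃ f' : X ⟶ Y, Cochain.ofHom f' = f :=
      ⟨(Cocycle.mk f 1 rfl hf).homOf, Cocycle.cochain_ofHom_homOf_eq_coe _⟩
    obtain ⟨z, hz⟩ := Cochain.equivHomotopy _ _ (h f).some
    rw [Cochain.ofHom_zero, add_zero] at hz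
    rw [hz]
    exact ht.sum_trace_δ_eq_zero hX a N (hbd _ (by lia)) (hbd _ (by lia)) g z
  rw [← LinearMap.range_dualMap_eq_dualAnnihilator_ker] at hL
  obtain ⟨ψ, hψ⟩ := hL
  replace hψ : ∀ f, ψ (δ 0 1 f) = L f := fun f => LinearMap.congr_fun hψ f
  choose s hs using fun i j : ℤ =>
    ht.exists_eq (hX j) (ψ ∘ₗ singleLinearMap k X Y j i 1)
  replace hs : ∀ (i j : ℤ) (f : X.X j ⟶ Y.X i),
    ψ (Cochain.single f 1) = t (X.X j) (f ≫ s i j) := hs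
  have key : ∀ i, i.negOnePow • g.f i = Y.d i (i + 1) ≫ s (i + 1) i - s i (i - 1) ≫ X.d (i - 1) i := by
    intro i
    by_cases hi : i < a ∨ a + N ≤ i
    · exact (hbd i hi).eq_of_tgt _ _
    rw [← sub_eq_zero]
    refine ht.eq_zero (hX i) _ fun f => ?_
    have h₁ : L (Cochain.single f 0) = t _ (f ≫ (i.negOnePow • g.f i)) := by
      obtain ⟨m, rfl⟩ : ∃ m : ℕ, i = a + m := ⟨(i - a).toNat, by lia⟩
      refine Eq.trans (Finset.sum_eq_single (M := k) (s := Finset.range N) m ?_ ?_) ?_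
      · intro j _ hj
        rw [Cochain.single_v_eq_zero _ _ _ _ _ (by lia), zero_comp, map_zero]
      · intro hm
        simp at hm
        lia
      · rw [Cochain.single_v]
    have h₂ := hψ (Cochain.single f 0)
    rw [Cochain.δ_single f 0 1 rfl (i - 1) (i + 1) (by lia) rfl, map_add, Int.negOnePow_one,
      Units.neg_smul, one_smul, map_neg, hs, hs, h₁, Category.assoc, Category.assoc,
      ht.comm (hX _) (hX _) (X.d (i - 1) i), Category.assoc] at h₂
    rw [Preadditive.comp_sub, Preadditive.comp_sub, map_sub, map_sub, ← h₂, ← sub_eq_add_neg,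
      sub_self]
  refine ⟨(Cochain.equivHomotopy _ _).symm
    ⟨Cochain.mk fun i j _ => j.negOnePow • s i j, ?_⟩⟩
  rw [Cochain.ofHom_zero, add_zero]
  ext i
  rw [δ_v (-1) 0 (by lia) _ i i (add_zero i) (i - 1) (i + 1) rfl rfl, Cochain.ofHom_v,
    Cochain.mk_v, Cochain.mk_v]
  have := congrArg (fun f => i.negOnePow • f) (key i)
  simp only [smul_smul, Int.units_mul_self, one_smul] at this
  rw [this]
  simp [Int.negOnePow_sub, sub_eq_add_neg (G := _ ⟶ _), add_comm (G := _ ⟶ _)]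

end IsPerfectTrace

end PerfectTrace

/-! ### The trace on finitely generated projectives over a symmetric algebra. -/

section FrobeniusTrace

open scoped ModuleCat

variable {k : Type w} [Field k] {R : Type u} [Ring R] [Algebra k R]

/-- A symmetrizing form of the `k`-algebra `R`. -/
structure IsSymmetrizingForm (τ : R →ₗ[k] k) : Prop where
  symm (a b : R) : τ (a * b) = τ (b * a)
  eq_zero (a : R) (ha : ∀ b, τ (b * a) = 0) : a = 0
  exists_eq (ψ : R →ₗ[k] k) : ∃ a, ∀ b, ψ b = τ (b * a)

/-- This is D(M) = Hom_R(M, R): the form `b ↦ ψ (b • x)` is represented by a unique element `h x`,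
and uniqueness makes `h` linear. -/
lemma IsSymmetrizingForm.exists_linearMap {τ : R →ₗ[k] k} (hτ : IsSymmetrizingForm τ)
    {M : ModuleCat.{v} R} (ψ : M →ₗ[k] k) : ∃ h : M →ₗ[R] R, ∀ x, ψ x = τ (h x) := by
  have key : ∀ x : M, ∃ a, ∀ b : R, ψ (b • x) = τ (b * a) := fun x =>
    hτ.exists_eq
      { toFun b := ψ (b • x)
        map_add' b c := by rw [add_smul, map_add]
        map_smul' c b := by rw [smul_assoc, map_smul]; rfl }
  choose h hh using key
  refine ⟨{ toFun := h, map_add' := fun x y => ?_, map_smul' := fun r x => ?_ }, fun x => ?_⟩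
  · rw [← sub_eq_zero]
    refine hτ.eq_zero _ fun b => ?_
    rw [mul_sub, mul_add, map_sub, map_add, ← hh, ← hh, ← hh, smul_add, map_add, sub_self]
  · rw [← sub_eq_zero]
    refine hτ.eq_zero _ fun b => ?_
    rw [mul_sub, map_sub, ← hh, smul_smul, hh, RingHom.id_apply, smul_eq_mul, mul_assoc, sub_self]
  · simpa using hh x 1

/-- The trace of an endomorphism of `Rⁿ` composed with the linear form `τ`. -/
noncomputable def freeTrace (τ : R →ₗ[k] k) {n : ℕ} (f : (Fin n → R) →ₗ[R] (Fin n → R)) : k :=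
  ∑ l, τ (f (Pi.single l 1) l)

lemma IsSymmetrizingForm.freeTrace_comm {τ : R →ₗ[k] k} (hτ : IsSymmetrizingForm τ) {m n : ℕ}
    (f : (Fin m → R) →ₗ[R] (Fin n → R)) (g : (Fin n → R) →ₗ[R] (Fin m → R)) :
    freeTrace τ (f ∘ₗ g) = freeTrace τ (g ∘ₗ f) := by
  have key : ∀ {m n : ℕ} (f : (Fin m → R) →ₗ[R] (Fin n → R)) (g : (Fin n → R) →ₗ[R] (Fin m → R)),
      freeTrace τ (f ∘ₗ g) =
        ∑ l, ∑ j, τ (g (Pi.single l 1) j * f (Pi.single j 1) l) := fun f g => by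
    refine Finset.sum_congr rfl fun l _ => ?_
    conv_lhs => rw [LinearMap.comp_apply, pi_eq_sum_univ' (g _)]
    simp [Finset.sum_apply]
  rw [key, key, Finset.sum_comm]
  simp only [hτ.symm]

open Classical in
/-- The trace of an endomorphism of a finitely generated projective module, composed with the
linear form `τ`. -/
noncomputable def projTrace (τ : R →ₗ[k] k) (Q : ModuleCat.{v} R) : (Q ⟶ Q) →ₗ[k] k :=
  if h : ∃ (n : ℕ) (p : (Fin n → R) →ₗ[R] Q) (i : Q →ₗ[R] (Fin n → R)), p ∘ₗ i = LinearMap.id then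
    { toFun f := freeTrace τ (h.choose_spec.choose_spec.choose ∘ₗ f.hom ∘ₗ
        h.choose_spec.choose)
      map_add' f g := by simp [freeTrace, Finset.sum_add_distrib]
      map_smul' c f := by
        have e : ∀ (n : ℕ) (i : Q →ₗ[R] (Fin n → R)) (x : Q) (l : Fin n), i (c • x) l = c • i x l := by
          intro n i x l
          rw [← algebraMap_smul R c x, map_smul, Pi.smul_apply, algebraMap_smul]
        simp [freeTrace, Finset.mul_sum, e] }
  else 0

/-- The finitely generated projective modules. -/
def finProj (R : Type u) [Ring R] : ObjectProperty (ModuleCat.{v} R) :=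
  fun M => Module.Finite R M ∧ Module.Projective R M

lemma exists_projTrace_eq (τ : R →ₗ[k] k) {Q : ModuleCat.{v} R} (hQ : finProj R Q) :
    ∃ (n : ℕ) (p : (Fin n → R) →ₗ[R] Q) (i : Q →ₗ[R] (Fin n → R)), (∀ x, p (i x) = x) ∧
      ∀ f, projTrace τ Q f = freeTrace τ (i ∘ₗ f.hom ∘ₗ p) := by
  obtain ⟨_, _⟩ := hQ
  have h : ∃ (n : ℕ) (p : (Fin n → R) →ₗ[R] Q) (i : Q →ₗ[R] (Fin n → R)),
      p ∘ₗ i = LinearMap.id := by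
    obtain ⟨n, f, g, -, -, h⟩ := Module.Finite.exists_comp_eq_id_of_projective R Q
    exact ⟨n, f, g, h⟩
  refine ⟨h.choose, h.choose_spec.choose, h.choose_spec.choose_spec.choose, fun x => ?_,
    fun f => ?_⟩
  · exact LinearMap.congr_fun h.choose_spec.choose_spec.choose_spec x
  · rw [projTrace, dif_pos h]; rfl

/-- Symmetrizing forms induce perfect traces on finitely generated projective modules. -/
theorem IsSymmetrizingForm.isPerfectTrace {τ : R →ₗ[k] k} (hτ : IsSymmetrizingForm τ) :
    IsPerfectTrace (finProj.{v} R) (projTrace τ) where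
  comm {Q Q'} hQ hQ' f g := by
    obtain ⟨n, p, i, hpi, h⟩ := exists_projTrace_eq τ hQ
    obtain ⟨n', p', i', hpi', h'⟩ := exists_projTrace_eq τ hQ'
    rw [h, h']
    have := hτ.freeTrace_comm (i ∘ₗ g.hom ∘ₗ p') (i' ∘ₗ f.hom ∘ₗ p)
    convert this using 2
    · refine LinearMap.ext fun x => ?_
      simp [hpi']
    · refine LinearMap.ext fun x => ?_
      simp [hpi]
  eq_zero {Q M} hQ g hg := by
    obtain ⟨n, p, i, hpi, h⟩ := exists_projTrace_eq τ hQ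
    ext x
    suffices H : i (g.hom x) = 0 by
      rw [← hpi (g.hom x), H, map_zero]; rfl
    ext j
    refine hτ.eq_zero _ fun b => ?_
    -- The trace against this rank one map is `τ (b * i (g x) j)`, so testing all `b` kills the
    -- `j`-th coordinate.
    have h₁ := hg (ModuleCat.ofHom (LinearMap.toSpanSingleton R M (b • x) ∘ₗ
      LinearMap.proj j ∘ₗ i))
    rw [h] at h₁
    have h₂ := hτ.freeTrace_comm (i ∘ₗ p) (i ∘ₗ g.hom ∘ₗ
      LinearMap.toSpanSingleton R M (b • x) ∘ₗ LinearMap.proj (R := R) (φ := fun _ : Fin n => R) j)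
    have h₃ : i ∘ₗ (ModuleCat.ofHom (LinearMap.toSpanSingleton R M (b • x) ∘ₗ
        LinearMap.proj j ∘ₗ i) ≫ g).hom ∘ₗ p = (i ∘ₗ g.hom ∘ₗ
        LinearMap.toSpanSingleton R M (b • x) ∘ₗ LinearMap.proj j) ∘ₗ i ∘ₗ p := rfl
    rw [h₃, ← h₂, freeTrace, Finset.sum_eq_single j] at h₁
    · simpa [hpi] using h₁
    · intro l _ hl
      simp [Pi.single_eq_of_ne' hl]
    · simp
  exists_eq {Q M} hQ ψ := by
    obtain ⟨n, p, i, hpi, h⟩ := exists_projTrace_eq τ hQ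
    -- Every map `f` from `Q` is a sum of rank one maps `q ↦ i q j • f (p eⱼ)`, so it suffices to
    -- represent `ψ` on these, for each `j`.
    have key : ∀ j : Fin n, ∃ h : M →ₗ[R] R, ∀ x, ψ (ModuleCat.ofHom
        (LinearMap.toSpanSingleton R M x ∘ₗ LinearMap.proj j ∘ₗ i)) = τ (h x) := fun j =>
      hτ.exists_linearMap
        { toFun x := ψ (ModuleCat.ofHom (LinearMap.toSpanSingleton R M x ∘ₗ LinearMap.proj j ∘ₗ i))
          map_add' x y := by
            rw [← map_add]
            congr 1
            ext q
            simp
          map_smul' c x := by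
            rw [RingHom.id_apply, ← map_smul]
            congr 1
            ext q
            simp only [ModuleCat.hom_smul, LinearMap.smul_apply, ModuleCat.hom_ofHom,
              LinearMap.comp_apply, LinearMap.toSpanSingleton_apply, LinearMap.proj_apply]
            exact smul_algebra_smul_comm c (i q j) x }
    choose s hs using key
    refine ⟨ModuleCat.ofHom (p ∘ₗ LinearMap.pi s), fun f => ?_⟩
    rw [h]
    have h₂ := hτ.freeTrace_comm (i ∘ₗ p) (LinearMap.pi s ∘ₗ f.hom ∘ₗ p)
    have h₃ : (LinearMap.pi s ∘ₗ f.hom ∘ₗ p) ∘ₗ (i ∘ₗ p) = LinearMap.pi s ∘ₗ f.hom ∘ₗ p := by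
      refine LinearMap.ext fun x => ?_
      simp [hpi]
    rw [h₃] at h₂
    refine Eq.trans ?_ h₂.symm
    simp only [freeTrace, LinearMap.comp_apply, LinearMap.pi_apply, ← hs, ← map_sum]
    congr 1
    ext q
    conv_lhs => rw [← hpi q, pi_eq_sum_univ' (i q)]
    simp [ModuleCat.hom_sum]

end FrobeniusTrace

/-! ### K^b(proj A) as a triangulated subcategory. -/

section FinProj

variable {R : Type u} [Ring R]

lemma finProj_of_retract {M N : ModuleCat.{v} R} (e : Retract M N) (hN : finProj R N) :
    finProj R M := by
  obtain ⟨_, _⟩ := hN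
  have h : e.r.hom ∘ₗ e.i.hom = LinearMap.id := by
    rw [← ModuleCat.hom_comp, e.retract, ModuleCat.hom_id]
  exact ⟨Module.Finite.of_surjective e.r.hom (fun x => ⟨e.i.hom x, LinearMap.congr_fun h x⟩),
    Module.Projective.of_split _ _ h⟩

lemma finProj_biprod {M N : ModuleCat.{v} R} (hM : finProj R M) (hN : finProj R N) :
    finProj R (M ⊞ N) := by
  obtain ⟨_, _⟩ := hM
  obtain ⟨_, _⟩ := hN
  have e := (ModuleCat.biprodIsoProd M N).symm.toLinearEquiv
  exact ⟨Module.Finite.equiv e, Module.Projective.of_equiv e⟩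

lemma finProj_of_isZero {M : ModuleCat.{v} R} (hM : IsZero M) : finProj R M := by
  have := ModuleCat.subsingleton_of_isZero hM
  exact ⟨inferInstance, inferInstance⟩

end FinProj

section KbProj

open ZeroObject

variable {A : Type u} [Ring A]

/-- Bounded complexes of finitely generated projective modules. -/
def IsBddFinProj (K : CochainComplex (ModuleCat.{u} Aᵐᵒᵖ) ℤ) : Prop :=
  (∃ a b : ℤ, ∀ i : ℤ, (i < a ∨ b < i) → IsZero (K.X i)) ∧ ∀ i, finProj Aᵐᵒᵖ (K.X i)

lemma kbProj_iff (X : KMod A) : KbProj A X ↔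
    ∃ K, IsBddFinProj K ∧ Nonempty (X ≅ (HomotopyCategory.quotient _ _).obj K) := by
  simp only [IsBddFinProj, and_assoc]
  rfl

lemma IsBddFinProj.kbProj {K : CochainComplex (ModuleCat.{u} Aᵐᵒᵖ) ℤ} (hK : IsBddFinProj K) :
    KbProj A ((HomotopyCategory.quotient _ _).obj K) :=
  (kbProj_iff _).2 ⟨K, hK, ⟨Iso.refl _⟩⟩

lemma IsBddFinProj.of_retract {K L : CochainComplex (ModuleCat.{u} Aᵐᵒᵖ) ℤ} (e : Retract K L)
    (hL : IsBddFinProj L) : IsBddFinProj K := by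
  obtain ⟨⟨a, b, h⟩, h'⟩ := hL
  refine ⟨⟨a, b, fun i hi => ?_⟩, fun i => finProj_of_retract
    (e.map (HomologicalComplex.eval _ _ i)) (h' i)⟩
  have e' : Retract (K.X i) (L.X i) := e.map (HomologicalComplex.eval _ _ i)
  rw [IsZero.iff_id_eq_zero, ← e'.retract, (h i hi).eq_of_tgt e'.i 0, zero_comp]

lemma isBddFinProj_mappingCone {K L : CochainComplex (ModuleCat.{u} Aᵐᵒᵖ) ℤ} (f : K ⟶ L)
    (hK : IsBddFinProj K) (hL : IsBddFinProj L) :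
    IsBddFinProj (CochainComplex.mappingCone f) := by
  obtain ⟨⟨a, b, h⟩, hK'⟩ := hK
  obtain ⟨⟨a', b', h'⟩, hL'⟩ := hL
  refine ⟨⟨min a a' - 1, max b b', fun i hi => ?_⟩, fun i => ?_⟩
  · rw [CochainComplex.mappingCone.isZero_X_iff]
    exact ⟨h _ (by grind), h' _ (by grind)⟩
  · exact finProj_of_retract (Retract.ofIso
      (HomologicalComplex.homotopyCofiber.XIsoBiprod f i (i + 1) rfl))
      (finProj_biprod (hK' _) (hL' _))

instance : (KbProj A).IsClosedUnderIsomorphisms where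
  of_iso e h := by
    obtain ⟨K, h₁, h₂, ⟨e'⟩⟩ := h
    exact ⟨K, h₁, h₂, ⟨e.symm ≪≫ e'⟩⟩

instance : (KbProj A).ContainsZero where
  exists_zero := ⟨(HomotopyCategory.quotient _ _).obj 0,
    Functor.map_isZero _ (isZero_zero _), IsBddFinProj.kbProj
      ⟨⟨0, 0, fun i _ => (HomologicalComplex.eval _ _ i).map_isZero (isZero_zero _)⟩,
        fun i => finProj_of_isZero ((HomologicalComplex.eval _ _ i).map_isZero (isZero_zero _))⟩⟩

instance : (KbProj A).IsStableUnderShift ℤ where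
  isStableUnderShiftBy n :=
    { le_shift X hX := by
        obtain ⟨K, ⟨⟨a, b, h⟩, h'⟩, ⟨e⟩⟩ := (kbProj_iff X).1 hX
        rw [ObjectProperty.prop_shift_iff, kbProj_iff]
        exact ⟨K⟦n⟧, ⟨⟨a - n, b - n, fun i hi => h (i + n) (by lia)⟩, fun i => h' (i + n)⟩,
          ⟨(shiftFunctor _ n).mapIso e ≪≫
            (((HomotopyCategory.quotient _ _).commShiftIso n).app K).symm⟩⟩ }

instance : (KbProj A).IsTriangulatedClosed₃ where
  ext₃' T hT h₁ h₂ := by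
    obtain ⟨K, hK, ⟨e₁⟩⟩ := (kbProj_iff _).1 h₁
    obtain ⟨L, hL, ⟨e₂⟩⟩ := (kbProj_iff _).1 h₂
    obtain ⟨f, hf⟩ := (HomotopyCategory.quotient _ _).map_surjective (e₁.inv ≫ T.mor₁ ≫ e₂.hom)
    refine ⟨_, (isBddFinProj_mappingCone f hK hL).kbProj,
      ⟨Triangle.π₃.mapIso (isoTriangleOfIso₁₂ T _ hT
        (HomotopyCategory.mappingCone_triangleh_distinguished f) e₁ e₂ ?_)⟩⟩
    change T.mor₁ ≫ e₂.hom = e₁.hom ≫ (HomotopyCategory.quotient _ _).map f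
    rw [hf, Iso.hom_inv_id_assoc]

instance : (KbProj A).IsTriangulated where
  toIsTriangulatedClosed₂ := .of_isTriangulatedClosed₃

end KbProj

/-! ### Duality for symmetric algebras. -/

section Duality

open scoped ModuleCat

variable {k : Type w} {A : Type u} [Field k] [Ring A] [Algebra k A]

/-- The form is `φ 1`: left and right linearity of `φ` give `φ a y = φ 1 (y * a) = φ 1 (a * y)`, and
bijectivity of `φ` gives nondegeneracy. -/
lemma IsSymmetricAlg.exists_isSymmetrizingForm (hA : IsSymmetricAlg k A) :
    ∃ τ : Aᵐᵒᵖ →ₗ[k] k, IsSymmetrizingForm τ := by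
  obtain ⟨φ, hφ⟩ := hA
  have h₁ : ∀ a y, φ a y = φ 1 (y * a) := fun a y => by simpa using hφ a 1 1 y
  have h₂ : ∀ a y, φ a y = φ 1 (a * y) := fun a y => by simpa using hφ 1 1 a y
  refine ⟨φ 1 ∘ₗ (MulOpposite.opLinearEquiv k).symm.toLinearMap, ⟨fun a b => ?_, fun a ha => ?_,
    fun ψ => ?_⟩⟩
  · simp only [LinearMap.comp_apply, LinearEquiv.coe_coe, MulOpposite.coe_opLinearEquiv_symm,
      MulOpposite.unop_mul]
    rw [← h₁, ← h₂]
  · rw [← MulOpposite.unop_eq_zero_iff, ← φ.map_eq_zero_iff]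
    ext y
    rw [h₂]
    exact ha (MulOpposite.op y)
  · obtain ⟨a, ha⟩ := φ.surjective (ψ ∘ₗ (MulOpposite.opLinearEquiv k).toLinearMap)
    refine ⟨MulOpposite.op a, fun b => ?_⟩
    have := h₂ a b.unop
    rw [ha] at this
    exact this

/-- A consequence of the duality `Hom(X, Y) ≅ D Hom(Y, X)` for symmetric algebras. -/
lemma IsSymmetricAlg.eq_zero_of_forall_eq_zero (hA : IsSymmetricAlg k A) {X Y : KMod A}
    (hX : KbProj A X) (h : ∀ f : X ⟶ Y, f = 0) (g : Y ⟶ X) : g = 0 := by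
  obtain ⟨τ, hτ⟩ := hA.exists_isSymmetrizingForm
  obtain ⟨K, ⟨⟨a, b, hab⟩, hK⟩, ⟨e⟩⟩ := (kbProj_iff X).1 hX
  obtain ⟨L, rfl⟩ := HomotopyCategory.quotient_obj_surjective Y
  obtain ⟨g', hg'⟩ := (HomotopyCategory.quotient _ _).map_surjective (g ≫ e.hom)
  rw [← cancel_mono e.hom, zero_comp, ← hg', HomotopyCategory.quotient_map_eq_zero_iff]
  refine hτ.isPerfectTrace.nonempty_homotopy_zero hK a (b - a + 1).toNat
    (fun i hi => hab i (by lia)) (fun f => ?_) g'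
  rw [← HomotopyCategory.quotient_map_eq_zero_iff, ← cancel_epi e.hom, h (e.hom ≫ _), comp_zero]

lemma IsSymmetricAlg.homVanish_neg (hA : IsSymmetricAlg k A) {X Y : KMod A} {n : ℤ}
    (hX : KbProj A X) (h : HomVanish X Y n) : HomVanish Y X (-n) := by
  have := hA.eq_zero_of_forall_eq_zero (Y := Y⟦n⟧) hX h
  rw [← zero_sub, ← homVanish_shift_left]
  intro g
  rw [← cancel_mono ((shiftFunctorZero _ ℤ).hom.app X), this (g ≫ _), zero_comp]

end Duality

/-! ### Generation of K^b(proj A) by A. -/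

section Generation

variable {A : Type u} [Ring A]

/-- The right regular module is isomorphic to `Aᵐᵒᵖ` as a left `Aᵐᵒᵖ`-module. -/
def regularLinearEquiv (A : Type u) [Ring A] : A ≃ₗ[Aᵐᵒᵖ] Aᵐᵒᵖ where
  toFun := MulOpposite.op
  invFun := MulOpposite.unop
  map_add' _ _ := rfl
  map_smul' _ _ := rfl
  left_inv _ := rfl
  right_inv _ := rfl

lemma finProj_regular : finProj Aᵐᵒᵖ (ModuleCat.of Aᵐᵒᵖ A) :=
  ⟨Module.Finite.equiv (regularLinearEquiv A).symm,
    Module.Projective.of_equiv (regularLinearEquiv A).symm⟩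

lemma isBddFinProj_single {M : ModuleCat.{u} Aᵐᵒᵖ} (hM : finProj Aᵐᵒᵖ M) (j : ℤ) :
    IsBddFinProj ((HomologicalComplex.single _ (ComplexShape.up ℤ) j).obj M) := by
  refine ⟨⟨j, j, fun i hi => HomologicalComplex.isZero_single_obj_X _ _ _ _ (by lia)⟩, fun i => ?_⟩
  by_cases hi : i = j
  · subst hi
    exact finProj_of_retract
      (Retract.ofIso (HomologicalComplex.singleObjXSelf (ComplexShape.up ℤ) i M)) hM
  · exact finProj_of_isZero (HomologicalComplex.isZero_single_obj_X _ _ _ _ hi)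

lemma kbProj_regularComplex : KbProj A (regularComplex A) :=
  (isBddFinProj_single finProj_regular 0).kbProj

lemma exists_retract_of_finProj {M : ModuleCat.{u} Aᵐᵒᵖ} (hM : finProj Aᵐᵒᵖ M) :
    ∃ n : ℕ, Nonempty (Retract M (⨁ fun _ : Fin n => ModuleCat.of Aᵐᵒᵖ A)) := by
  obtain ⟨_, _⟩ := hM
  obtain ⟨n, f, g, -, -, h⟩ := Module.Finite.exists_comp_eq_id_of_projective Aᵐᵒᵖ M
  let e : (Fin n → Aᵐᵒᵖ) ≃ₗ[Aᵐᵒᵖ] (Fin n → A) :=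
    LinearEquiv.piCongrRight fun _ => (regularLinearEquiv A).symm
  let e' : ModuleCat.of Aᵐᵒᵖ (Fin n → Aᵐᵒᵖ) ≅ ⨁ fun _ : Fin n => ModuleCat.of Aᵐᵒᵖ A :=
    e.toModuleIso ≪≫ (ModuleCat.biproductIsoPi fun _ : Fin n => ModuleCat.of Aᵐᵒᵖ A).symm
  exact ⟨n, ⟨⟨ModuleCat.ofHom g ≫ e'.hom, e'.inv ≫ ModuleCat.ofHom f, by
    rw [Category.assoc, Iso.hom_inv_id_assoc, ← ModuleCat.ofHom_comp, h]
    rfl⟩⟩⟩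

variable {Q : ObjectProperty (KMod A)} [Q.IsTriangulated] [Q.IsStableUnderRetracts]

lemma prop_single (hQ : Q (regularComplex A)) {M : ModuleCat.{u} Aᵐᵒᵖ} (hM : finProj Aᵐᵒᵖ M)
    (j : ℤ) : Q ((HomotopyCategory.singleFunctor _ j).obj M) := by
  obtain ⟨n, ⟨e⟩⟩ := exists_retract_of_finProj hM
  have h₀ : Q ((HomotopyCategory.singleFunctor _ 0).obj M) := by
    refine Q.prop_of_retract (e.map (HomotopyCategory.singleFunctor _ 0)) ?_
    refine Q.prop_of_iso (Functor.mapBiproduct (HomotopyCategory.singleFunctor _ 0) _ ≪≫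
      biproduct.isoProduct _).symm ?_
    exact Q.prop_product fun _ => hQ
  refine Q.prop_of_iso (((HomotopyCategory.singleFunctors _).shiftIso (-j) j 0 (by lia)).app M) ?_
  exact Q.le_shift _ _ h₀

end Generation

section BrutalTruncation

variable {C : Type u} [Category.{v} C] [Abelian C]

open HomologicalComplex

/-- A bounded above complex is an extension of its brutal truncation by its last term. -/
lemma exists_triangle_of_isZero (K : CochainComplex C ℤ) (b : ℤ) (hb : IsZero (K.X (b + 1))) :
    ∃ (K' : CochainComplex C ℤ) (T : Triangle (HomotopyCategory C (ComplexShape.up ℤ))),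
      T ∈ distTriang _ ∧ T.obj₁ = (HomotopyCategory.singleFunctor C b).obj (K.X b) ∧
      T.obj₂ = (HomotopyCategory.quotient _ _).obj K ∧
      T.obj₃ = (HomotopyCategory.quotient _ _).obj K' ∧
      IsZero (K'.X b) ∧ ∀ i, i ≠ b → Nonempty (K.X i ≅ K'.X i) := by
  let f : (single C (ComplexShape.up ℤ) b).obj (K.X b) ⟶ K :=
    mkHomFromSingle (𝟙 _) (fun i hi => by
      obtain rfl : b + 1 = i := hi
      exact hb.eq_of_tgt _ _)
  have hf : IsIso (f.f b) := by
    rw [mkHomFromSingle_f]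
    infer_instance
  have hz : ∀ i, i ≠ b → IsZero (((single C (ComplexShape.up ℤ) b).obj (K.X b)).X i) :=
    fun i hi => isZero_single_obj_X _ _ _ _ hi
  have : Mono f := mono_of_mono_f _ fun i => by
    by_cases hi : i = b
    · subst hi; infer_instance
    · exact (hz i hi).mono _
  let S : ShortComplex (CochainComplex C ℤ) := ShortComplex.mk f (cokernel.π f) (by simp)
  have hS : S.ShortExact :=
    { exact := ShortComplex.exact_of_g_is_cokernel _ (cokernelIsCokernel f)
      mono_f := this
      epi_g := by dsimp [S]; infer_instance }
  have hSi : ∀ i, (S.map (eval C _ i)).ShortExact := fun i => hS.map_of_exact _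
  have h₁ : IsZero (S.X₃.X b) := by
    have := (hSi b).epi_g
    refine IsZero.of_epi_eq_zero (S.g.f b) ?_
    rw [← cancel_epi (f.f b), comp_zero, ← comp_f, S.zero, zero_f]
  have h₂ : ∀ i, i ≠ b → IsIso (S.g.f i) := fun i hi => by
    have := (hSi i).epi_g
    have : Mono (S.g.f i) := (hSi i).exact.mono_g ((hz i hi).eq_of_src _ _)
    exact isIso_of_mono_of_epi _
  -- The sequence splits degreewise because an outer term vanishes in each degree: the quotient in
  -- degree `b`, the subcomplex elsewhere.
  let σ : ∀ i, (S.map (eval C _ i)).Splitting := fun i =>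
    if hi : i = b then
      ShortComplex.Splitting.ofIsIsoOfIsZero _ (by subst hi; exact hf) (by subst hi; exact h₁)
    else ShortComplex.Splitting.ofIsZeroOfIsIso _ (hz i hi) (h₂ i hi)
  refine ⟨S.X₃, CochainComplex.trianglehOfDegreewiseSplit S σ,
    (HomotopyCategory.distinguished_iff_iso_trianglehOfDegreewiseSplit _).2
      ⟨S, σ, ⟨Iso.refl _⟩⟩, rfl, rfl, rfl, h₁, fun i hi => ⟨?_⟩⟩
  have := h₂ i hi
  exact asIso (S.g.f i)

end BrutalTruncation

section Generation

variable {A : Type u} [Ring A] {Q : ObjectProperty (KMod A)} [Q.IsTriangulated]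
  [Q.IsStableUnderRetracts]

/-- `K^b(proj A)` is contained in each thick subcategory which contains `A`. -/
theorem kbProj_le_of_regularComplex (hQ : Q (regularComplex A)) : KbProj A ≤ Q := by
  have key : ∀ (N : ℕ) (a : ℤ) (K : CochainComplex (ModuleCat.{u} Aᵐᵒᵖ) ℤ),
      (∀ i, (i < a ∨ a + N ≤ i) → IsZero (K.X i)) → (∀ i, finProj Aᵐᵒᵖ (K.X i)) →
      Q ((HomotopyCategory.quotient _ _).obj K) := by
    intro N
    induction N with
    | zero =>
      intro a K hK _
      refine ObjectProperty.prop_of_isZero Q (Functor.map_isZero _ ?_)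
      rw [IsZero.iff_id_eq_zero]
      ext1 i
      exact (hK i (by lia)).eq_of_src _ _
    | succ N ih =>
      intro a K hK hK'
      obtain ⟨K', T, hT, e₁, e₂, e₃, h, h'⟩ := exists_triangle_of_isZero K (a + N)
        (hK _ (by lia))
      rw [← e₂]
      refine Q.ext_of_isTriangulatedClosed₂ T hT (e₁ ▸ prop_single hQ (hK' _) _)
        (e₃ ▸ ih a K' (fun i hi => ?_) (fun i => ?_))
      · by_cases hi' : i = a + N
        · rwa [hi']
        · exact (hK i (by lia)).of_iso (h' i hi').some.symm
      · by_cases hi' : i = a + N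
        · rw [hi']
          exact finProj_of_isZero h
        · exact finProj_of_retract (Retract.ofIso (h' i hi').some.symm) (hK' i)
  intro X hX
  obtain ⟨K, ⟨⟨a, b, hab⟩, hK⟩, ⟨e⟩⟩ := (kbProj_iff X).1 hX
  exact Q.prop_of_iso e.symm (key (b - a + 1).toNat a K (fun i hi => hab i (by lia)) hK)

end Generation

/-! ### Cohomology as Hom from A. -/

section Cohomology

variable {A : Type u} [Ring A]

open CochainComplex HomComplex

/-- `Hom(A, X[i])` is the cohomology module `H^i(X)`. -/
lemma homVanish_regularComplex_iff (X : KMod A) (i : ℤ) :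
    HomVanish (regularComplex A) X i ↔ IsZero (cohomology X i) := by
  obtain ⟨K, rfl⟩ := HomotopyCategory.quotient_obj_surjective X
  have h₁ : IsZero (cohomology ((HomotopyCategory.quotient _ _).obj K) i) ↔
      ∀ x : K.X i, K.d i (i + 1) x = 0 → ∃ y : K.X (i - 1), K.d (i - 1) i y = x := by
    rw [show IsZero (cohomology ((HomotopyCategory.quotient _ _).obj K) i) ↔
      IsZero (K.homology i) from
        ((HomotopyCategory.homologyFunctorFactors _ _ i).app K).isZero_iff,
      ← HomologicalComplex.exactAt_iff_isZero_homology, HomologicalComplex.exactAt_iff' K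
        (i - 1) i (i + 1) (by simp) (by simp), ShortComplex.moduleCat_exact_iff]
    rfl
  have h₂ : HomVanish (regularComplex A) ((HomotopyCategory.quotient _ _).obj K) i ↔
      ∀ f : ModuleCat.of Aᵐᵒᵖ A ⟶ K.X i, f ≫ K.d i (i + 1) = 0 →
        ∃ g : ModuleCat.of Aᵐᵒᵖ A ⟶ K.X (i - 1), g ≫ K.d (i - 1) i = f := by
    have e : HomVanish (regularComplex A) ((HomotopyCategory.quotient _ _).obj K) i ↔
        ∀ f : (HomotopyCategory.quotient _ _).obj ((singleFunctor _ 0).obj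
          (ModuleCat.of Aᵐᵒᵖ A)) ⟶ (HomotopyCategory.quotient _ _).obj (K⟦i⟧), f = 0 := by
      let e := ((HomotopyCategory.quotient (ModuleCat.{u} Aᵐᵒᵖ)
        (ComplexShape.up ℤ)).commShiftIso i).app K
      constructor
      · intro h f
        exact (cancel_mono e.hom).1 ((h (f ≫ e.hom)).trans zero_comp.symm)
      · intro h f
        exact (cancel_mono e.inv).1 ((h (f ≫ e.inv)).trans zero_comp.symm)
    rw [e]
    constructor
    · intro h f hf
      rw [← Cocycle.fromSingleMk_mem_coboundaries_iff f (zero_add i) (i + 1) rfl hf (i - 1)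
        (by lia), ← CohomologyClass.toHom_mk_eq_zero_iff]
      exact h _
    · intro h f
      obtain ⟨x, rfl⟩ := (CohomologyClass.toHom_bijective _ _ _).2 f
      obtain ⟨x, rfl⟩ := CohomologyClass.mk_surjective x
      obtain ⟨f, hf, rfl⟩ := Cocycle.fromSingleMk_surjective x i (zero_add i) (i + 1) rfl
      rw [CohomologyClass.toHom_mk_eq_zero_iff,
        Cocycle.fromSingleMk_mem_coboundaries_iff f (zero_add i) (i + 1) rfl hf (i - 1) (by lia)]
      exact h f hf
  -- The inverse of evaluation at 1; it translates exactness on elements into exactness on maps from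
  -- `A`.
  let ι : ∀ {M : ModuleCat.{u} Aᵐᵒᵖ}, M → (ModuleCat.of Aᵐᵒᵖ A ⟶ M) := fun {M} x =>
    ModuleCat.ofHom (LinearMap.toSpanSingleton Aᵐᵒᵖ M x ∘ₗ (regularLinearEquiv A).toLinearMap)
  have hι : ∀ {M : ModuleCat.{u} Aᵐᵒᵖ} (x : M), (ι x).hom (1 : A) = x := fun x => one_smul _ x
  have hι' : ∀ {M : ModuleCat.{u} Aᵐᵒᵖ} (f : ModuleCat.of Aᵐᵒᵖ A ⟶ M), ι (f.hom (1 : A)) = f := by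
    intro M f
    refine ModuleCat.hom_ext (LinearMap.ext fun (a : A) => ?_)
    have := f.hom.map_smul (MulOpposite.op (a : A)) (1 : A)
    rw [← show a = MulOpposite.op (a : A) • (1 : A) from (one_mul a).symm] at this
    exact this.symm
  rw [h₁, h₂]
  constructor
  · intro h x hx
    obtain ⟨g, hg⟩ := h (ι x) (by
      rw [← hι' (ι x ≫ _), ModuleCat.hom_comp, LinearMap.comp_apply, hι]
      rw [hx, ← hι' 0])
    refine ⟨g.hom (1 : A), ?_⟩
    rw [← hι x, ← hg]
    rfl
  · intro h f hf
    obtain ⟨y, hy⟩ := h (f.hom (1 : A)) (by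
      rw [← LinearMap.comp_apply, ← ModuleCat.hom_comp, hf]; rfl)
    refine ⟨ι y, ?_⟩
    rw [← hι' f, ← hy, ← hι' (ι y ≫ _), ModuleCat.hom_comp, LinearMap.comp_apply, hι]

end Cohomology

/-! ### Splitting of idempotents in K^b(proj A). -/

section IdempotentLifting

open Polynomial

/-- Idempotents lift along homomorphisms from finite-dimensional algebras. -/
lemma exists_isIdempotentElem_map_eq {k S T : Type*} [Field k] [Ring S] [Algebra k S] [Ring T]
    [Algebra k T] [Module.Finite k S] (f : S →ₐ[k] T) (a : S) (ha : IsIdempotentElem (f a)) :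
    ∃ b, IsIdempotentElem b ∧ f b = f a := by
  obtain ⟨q, hq, hqa⟩ := IsIntegral.of_finite k a
  rw [← aeval_def] at hqa
  obtain ⟨q₁, hq₁, hq₂⟩ := exists_eq_pow_rootMultiplicity_mul_and_not_dvd q hq.ne_zero 0
  set m := q.rootMultiplicity 0
  rw [C_0, sub_zero] at hq₁ hq₂
  -- The lift is Fitting's projection `x X ^ (m + 1)` evaluated at `a`. The exponent `m + 1`, not
  -- `m`, keeps it positive when `m = 0`, so that powers of the idempotent `f a` collapse.
  obtain ⟨x, y, hxy⟩ : IsCoprime (X ^ (m + 1)) q₁ :=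
    (irreducible_X.coprime_iff_not_dvd.2 hq₂).pow_left
  have h₁ : ∀ n, f a ^ (n + 1) = f a := fun n => ha.pow_succ_eq n
  refine ⟨aeval a (x * X ^ (m + 1)), ?_, ?_⟩
  · have : x * X ^ (m + 1) * (x * X ^ (m + 1)) = x * X ^ (m + 1) - x * X * y * q := by
      rw [hq₁]
      linear_combination x * X ^ (m + 1) * hxy
    rw [IsIdempotentElem, ← map_mul, this, map_sub, map_mul _ _ q, hqa, mul_zero, sub_zero]
  · have h₂ : aeval (f a) (X * q₁) = 0 := by
      have : aeval (f a) (X * q) = 0 := by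
        rw [map_mul, aeval_algHom_apply f a q, hqa, map_zero, mul_zero]
      rw [hq₁, ← mul_assoc, ← pow_succ', map_mul, map_pow, aeval_X, h₁] at this
      rw [map_mul, aeval_X, this]
    have h₃ := congrArg (fun p => aeval (f a) (X * p)) hxy
    have h₄ : X * (x * X ^ (m + 1) + y * q₁) = x * X ^ (m + 2) + y * (X * q₁) := by ring
    simp only [h₄, map_add, map_mul _ y, h₂, mul_zero, add_zero, mul_one, aeval_X] at h₃
    rw [← aeval_algHom_apply, map_mul, map_pow, aeval_X, h₁]
    rwa [map_mul, map_pow, aeval_X, h₁] at h₃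

end IdempotentLifting

section FiniteDimensional

open scoped ModuleCat

variable {k : Type w} [Field k]

lemma moduleFinite_hom_moduleCat {R : Type u} [Ring R] [Algebra k R] [Module.Finite k R]
    {M N : ModuleCat.{v} R} [Module.Finite R M] [Module.Finite R N] :
    Module.Finite k (M ⟶ N) := by
  have : Module.Finite k N := Module.Finite.trans R N
  obtain ⟨n, p, hp⟩ := Module.Finite.exists_fin' R M
  let F : (M ⟶ N) →ₗ[k] (Fin n → N) :=
    { toFun f l := f.hom (p (Pi.single l 1))
      map_add' _ _ := rfl
      map_smul' _ _ := rfl }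
  refine Module.Finite.of_injective F fun f g hfg => ModuleCat.hom_ext ?_
  rw [← LinearMap.cancel_right hp]
  refine LinearMap.pi_ext' fun l => LinearMap.ext_ring ?_
  exact congrFun hfg l

lemma moduleFinite_hom_cochainComplex {C : Type u} [Category.{v} C] [Preadditive C] [Linear k C]
    {K L : CochainComplex C ℤ} (a b : ℤ) (h : ∀ i, (i < a ∨ b < i) → IsZero (K.X i))
    (hKL : ∀ i, Module.Finite k (K.X i ⟶ L.X i)) : Module.Finite k (K ⟶ L) := by
  let F : (K ⟶ L) →ₗ[k] (∀ i : Finset.Icc a b, K.X i ⟶ L.X i) :=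
    { toFun f i := f.f i
      map_add' _ _ := rfl
      map_smul' _ _ := rfl }
  refine Module.Finite.of_injective F fun f g hfg => ?_
  ext i
  by_cases hi : i ∈ Finset.Icc a b
  · exact congrFun hfg ⟨i, hi⟩
  · exact (h i (by grind)).eq_of_src _ _

variable {A : Type u} [Ring A] [Algebra k A] [Module.Finite k A]

lemma IsBddFinProj.moduleFinite_hom {K L : CochainComplex (ModuleCat.{u} Aᵐᵒᵖ) ℤ}
    (hK : IsBddFinProj K) (hL : IsBddFinProj L) : Module.Finite k (K ⟶ L) := by
  have : Module.Finite k Aᵐᵒᵖ := Module.Finite.equiv (MulOpposite.opLinearEquiv k)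
  obtain ⟨⟨a, b, h⟩, hK⟩ := hK
  refine moduleFinite_hom_cochainComplex a b h fun i => ?_
  have := (hK i).1
  have := (hL.2 i).1
  exact moduleFinite_hom_moduleCat

lemma moduleFinite_hom_of_kbProj {X Y : KMod A} (hX : KbProj A X) (hY : KbProj A Y) :
    Module.Finite k (X ⟶ Y) := by
  obtain ⟨K, hK, ⟨e⟩⟩ := (kbProj_iff X).1 hX
  obtain ⟨L, hL, ⟨e'⟩⟩ := (kbProj_iff Y).1 hY
  have : Module.Finite k (K ⟶ L) := hK.moduleFinite_hom hL
  have : Module.Finite k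
      ((HomotopyCategory.quotient _ _).obj K ⟶ (HomotopyCategory.quotient _ _).obj L) :=
    Module.Finite.of_surjective (Functor.mapLinearMap k (HomotopyCategory.quotient _ _))
      (HomotopyCategory.quotient _ _).map_surjective
  exact Module.Finite.equiv (Linear.homCongr k e e').symm

/-- Idempotents split in `K^b(proj A)`. -/
lemma exists_retract_of_kbProj (k : Type w) [Field k] [Algebra k A] [Module.Finite k A]
    {X : KMod A} (hX : KbProj A X) (e : X ⟶ X) (he : e ≫ e = e) :
    ∃ (Y : KMod A) (r : Retract Y X), KbProj A Y ∧ r.r ≫ r.i = e := by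
  obtain ⟨K, hK, ⟨α⟩⟩ := (kbProj_iff X).1 hX
  let q := HomotopyCategory.quotient (ModuleCat.{u} Aᵐᵒᵖ) (ComplexShape.up ℤ)
  let f : End K →ₐ[k] End (q.obj K) :=
    { toFun := q.map
      map_one' := q.map_id K
      map_mul' _ _ := q.map_comp _ _
      map_zero' := q.map_zero _ _
      map_add' _ _ := q.map_add
      commutes' c := by
        rw [Algebra.algebraMap_eq_smul_one, Algebra.algebraMap_eq_smul_one]
        exact (q.map_smul _ _).trans (congrArg _ (q.map_id K)) }
  have : Module.Finite k (End K) := hK.moduleFinite_hom hK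
  obtain ⟨a, ha⟩ := q.map_surjective (α.inv ≫ e ≫ α.hom)
  obtain ⟨b, hb, hba⟩ := exists_isIdempotentElem_map_eq f a (by
    change q.map a ≫ q.map a = q.map a
    rw [ha]
    simp [reassoc_of% he])
  obtain ⟨K', i, r, hir, hri⟩ := IsIdempotentComplete.idempotents_split K b hb
  let R : Retract K' K := ⟨i, r, hir⟩
  refine ⟨q.obj K', (R.map q).trans (Retract.ofIso α.symm), (hK.of_retract R).kbProj, ?_⟩
  change (α.hom ≫ q.map r) ≫ q.map i ≫ α.inv = e
  have hba' : q.map b = q.map a := hba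
  rw [Category.assoc, ← Functor.map_comp_assoc, hri, hba', ha]
  simp

/-- The idempotent of the retract also splits inside K^b(proj A), and two splittings of one
idempotent are isomorphic. -/
lemma kbProj_isStableUnderRetracts (k : Type w) [Field k] [Algebra k A] [Module.Finite k A]
    : (KbProj A).IsStableUnderRetracts where
  of_retract {X Y} r hY := by
    obtain ⟨Z, r', hZ, h⟩ := exists_retract_of_kbProj k hY (r.r ≫ r.i) (by simp)
    refine (KbProj A).prop_of_iso ⟨r'.i ≫ r.r, r.i ≫ r'.r, ?_, ?_⟩ hZ
    · rw [Category.assoc, ← Category.assoc r.r, ← h]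
      simp
    · rw [Category.assoc, ← Category.assoc r'.r, h]
      simp

end FiniteDimensional

/-! ### Projective covers and existence of the sequence. -/

section ProjectiveCover

/-- A finite length projective module `F` with a surjection `f : F → M` has a direct summand, the
image of the idempotent `π`, which is a projective cover of `M`. -/
lemma exists_idempotent_minimal {E F M : Type*} [Ring E] [AddCommGroup F] [Module E F]
    [AddCommGroup M] [Module E M] [IsArtinian E F] [IsNoetherian E F] [Module.Projective E F]
    (f : F →ₗ[E] M) (hf : Function.Surjective f) :
    ∃ π : F →ₗ[E] F, π ∘ₗ π = π ∧ f ∘ₗ π = f ∧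
      ∀ L ≤ LinearMap.range π, L.map f = ⊤ → L = LinearMap.range π := by
  -- Take `N` minimal among submodules mapping onto `M`, and lift `f` to `h : F → N`. By minimality
  -- `h` is onto when restricted to `N`, hence bijective there; correcting `h` by the inverse gives
  -- a projection onto `N`.
  obtain ⟨N, hN, hmin⟩ := IsArtinian.set_has_minimal {N : Submodule E F | N.map f = ⊤}
    ⟨⊤, by simpa using LinearMap.range_eq_top.2 hf⟩
  replace hN : N.map f = ⊤ := hN
  replace hmin : ∀ L ≤ N, L.map f = ⊤ → L = N := fun L hL hL' =>
    hL.eq_of_not_lt fun h => hmin L hL' h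
  have hg : Function.Surjective (f ∘ₗ N.subtype) := by
    rw [← LinearMap.range_eq_top, LinearMap.range_comp, Submodule.range_subtype, hN]
  obtain ⟨h, hh⟩ := Module.projective_lifting_property _ f hg
  have hh' : ∀ x, f (h x) = f x := LinearMap.congr_fun hh
  have hsurj : Function.Surjective (h ∘ₗ N.subtype) := by
    have : (LinearMap.range (h ∘ₗ N.subtype)).map N.subtype = N := by
      refine hmin _ (Submodule.map_subtype_le _ _) ?_
      rw [eq_top_iff, ← hN]
      rintro _ ⟨x, hx, rfl⟩
      exact ⟨h x, ⟨_, ⟨⟨x, hx⟩, rfl⟩, rfl⟩, hh' x⟩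
    intro y
    obtain ⟨z, ⟨x, hx⟩, hz⟩ := this.ge y.2
    exact ⟨x, hx.trans (Subtype.ext hz)⟩
  let ψ := LinearEquiv.ofBijective (h ∘ₗ N.subtype)
    ⟨IsNoetherian.injective_of_surjective_endomorphism _ hsurj, hsurj⟩
  have hψ : ∀ x : N, ψ.symm (h x) = x := fun x => ψ.symm_apply_apply x
  have hψ' : ∀ x : N, h (ψ.symm x : F) = x := fun x => ψ.apply_symm_apply x
  have hrange : LinearMap.range (N.subtype ∘ₗ ψ.symm.toLinearMap ∘ₗ h) = N := by
    ext x
    constructor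
    · rintro ⟨y, rfl⟩
      exact (ψ.symm (h y)).2
    · intro hx
      exact ⟨x, congrArg Subtype.val (hψ ⟨x, hx⟩)⟩
  refine ⟨N.subtype ∘ₗ ψ.symm.toLinearMap ∘ₗ h, ?_, ?_, by rwa [hrange]⟩
  · ext x
    exact congrArg Subtype.val (hψ (ψ.symm (h x)))
  · ext x
    change f (ψ.symm (h x)) = f x
    rw [← hh', hψ', hh']

end ProjectiveCover

section Coyoneda

variable {C : Type u} [Category.{v} C] [Preadditive C]

lemma end_op_smul_eq {P X : C} (r : (End P)ᵐᵒᵖ) (x : P ⟶ X) : r • x = r.unop ≫ x := rfl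

variable [HasFiniteBiproducts C]

/-- `Hom(P, Pⁿ)` is a free `End(P)`-module. -/
noncomputable def homBiproductEquiv (P : C) (n : ℕ) :
    (P ⟶ ⨁ fun _ : Fin n => P) ≃ₗ[(End P)ᵐᵒᵖ] (Fin n → (End P)ᵐᵒᵖ) where
  toFun x j := MulOpposite.op (x ≫ biproduct.π _ j)
  invFun a := biproduct.lift fun j => (a j).unop
  map_add' x y := by ext j; simp [Preadditive.add_comp]
  map_smul' r x := by
    ext j
    exact congrArg MulOpposite.op (Category.assoc _ _ _)
  left_inv x := by ext j; simp
  right_inv a := by ext j; simp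

/-- Linear maps from `Hom(P, Pⁿ)` to `Hom(P, Y)` are induced by morphisms. -/
lemma exists_comp_eq {P Y : C} {n : ℕ}
    (φ : (P ⟶ ⨁ fun _ : Fin n => P) →ₗ[(End P)ᵐᵒᵖ] (P ⟶ Y)) :
    ∃ e : (⨁ fun _ : Fin n => P) ⟶ Y, ∀ x, φ x = x ≫ e := by
  refine ⟨biproduct.desc fun j => φ (biproduct.ι (fun _ : Fin n => P) j), fun x => ?_⟩
  have hx : x = ∑ j, (MulOpposite.op (x ≫ biproduct.π _ j) : (End P)ᵐᵒᵖ) •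
      biproduct.ι (fun _ : Fin n => P) j := by
    simp only [end_op_smul_eq, MulOpposite.unop_op, Category.assoc]
    rw [← Preadditive.comp_sum, biproduct.total, Category.comp_id]
  have h₁ := congrArg φ hx
  rw [map_sum] at h₁
  rw [h₁]
  conv_rhs => rw [hx]
  rw [Preadditive.sum_comp]
  refine Finset.sum_congr rfl fun j _ => ?_
  rw [φ.map_smul, end_op_smul_eq, end_op_smul_eq, Category.assoc, biproduct.ι_desc]

variable {k : Type w} [Field k] [Linear k C]

/-- The existence of `Q` in `add P` and of `g : Q ⟶ X` such that `Hom(P, g)` is a projective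
cover. -/
theorem exists_isProjectiveCover (P X : C) [Module.Finite k (End P)] [Module.Finite k (P ⟶ X)]
    (hP : ∀ (n : ℕ) (e : (⨁ fun _ : Fin n => P) ⟶ ⨁ fun _ : Fin n => P), e ≫ e = e →
      ∃ (Q : C) (r : Retract Q (⨁ fun _ : Fin n => P)), r.r ≫ r.i = e) :
    ∃ (Q : C) (g : Q ⟶ X), InAdd P Q ∧
      IsProjectiveCover ((preadditiveCoyonedaObj P).map g).hom := by
  have : Module.Finite k (End P)ᵐᵒᵖ := Module.Finite.equiv (MulOpposite.opLinearEquiv k)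
  have : IsArtinianRing (End P)ᵐᵒᵖ := IsArtinianRing.of_finite k _
  have : IsScalarTower k (End P)ᵐᵒᵖ (P ⟶ X) := ⟨fun c r x => Linear.smul_comp _ _ _ c r.unop x⟩
  have : Module.Finite (End P)ᵐᵒᵖ (P ⟶ X) := Module.Finite.of_restrictScalars_finite k _ _
  obtain ⟨n, s, hs⟩ := Module.Finite.exists_fin (R := (End P)ᵐᵒᵖ) (M := (P ⟶ X))
  let g := biproduct.desc s
  let f : (P ⟶ ⨁ fun _ : Fin n => P) →ₗ[(End P)ᵐᵒᵖ] (P ⟶ X) :=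
    ((preadditiveCoyonedaObj P).map g).hom
  have hf : ∀ x, f x = x ≫ g := fun _ => rfl
  have hf' : Function.Surjective f := by
    rw [← LinearMap.range_eq_top, eq_top_iff, ← hs, Submodule.span_le]
    rintro _ ⟨j, rfl⟩
    exact ⟨biproduct.ι (fun _ : Fin n => P) j, biproduct.ι_desc s j⟩
  have : Module.Finite (End P)ᵐᵒᵖ (P ⟶ ⨁ fun _ : Fin n => P) :=
    Module.Finite.equiv (homBiproductEquiv P n).symm
  have : Module.Projective (End P)ᵐᵒᵖ (P ⟶ ⨁ fun _ : Fin n => P) :=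
    Module.Projective.of_equiv (homBiproductEquiv P n).symm
  obtain ⟨π, hπ, hfπ, hmin⟩ := exists_idempotent_minimal f hf'
  -- Hom(P, -) is full on maps out of Pⁿ, so the module idempotent comes from a morphism, whose
  -- splitting is `Q`.
  obtain ⟨e, he⟩ := exists_comp_eq π
  have hee : e ≫ e = e := by
    refine biproduct.hom_ext' _ _ fun j => ?_
    rw [← Category.assoc, ← he, ← he, ← LinearMap.comp_apply, hπ]
  obtain ⟨Q, r, hr⟩ := hP n e hee
  let i' : (P ⟶ Q) →ₗ[(End P)ᵐᵒᵖ] (P ⟶ ⨁ fun _ : Fin n => P) :=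
    ((preadditiveCoyonedaObj P).map r.i).hom
  let r' : (P ⟶ ⨁ fun _ : Fin n => P) →ₗ[(End P)ᵐᵒᵖ] (P ⟶ Q) :=
    ((preadditiveCoyonedaObj P).map r.r).hom
  have hir : ∀ x, r' (i' x) = x := fun x => by
    change (x ≫ r.i) ≫ r.r = x
    rw [Category.assoc, r.retract, Category.comp_id]
  have hri : ∀ x, i' (r' x) = π x := fun x => by
    change (x ≫ r.r) ≫ r.i = π x
    rw [Category.assoc, hr, he]
  let g' : (P ⟶ Q) →ₗ[(End P)ᵐᵒᵖ] (P ⟶ X) := ((preadditiveCoyonedaObj P).map (r.i ≫ g)).hom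
  have hg' : ∀ x, g' x = f (i' x) := fun x => (Category.assoc _ _ _).symm
  have hrange : LinearMap.range i' = LinearMap.range π := by
    refine le_antisymm ?_ ?_
    · rintro _ ⟨x, rfl⟩
      exact ⟨i' x, by rw [← hri, hir]⟩
    · rintro _ ⟨x, rfl⟩
      exact ⟨r' x, hri x⟩
  have hcover : IsProjectiveCover g' :=
    { projective := Module.Projective.of_split i' r' (LinearMap.ext hir)
      surjective := fun x => by
        obtain ⟨y, rfl⟩ := hf' x
        exact ⟨r' y, by rw [hg', hri]; exact LinearMap.congr_fun hfπ y⟩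
      superfluous := fun N hN => by
        have h₁ : N.map i' = LinearMap.range π := by
          refine hmin _ (hrange ▸ LinearMap.map_le_range) ?_
          rw [eq_top_iff]
          rintro x -
          obtain ⟨y, rfl⟩ := hf' x
          obtain ⟨a, ha, b, hb, hab⟩ := Submodule.mem_sup.1 (hN.ge (Submodule.mem_top (x := r' y)))
          refine ⟨i' a, ⟨a, ha, rfl⟩, ?_⟩
          rw [← hg', ← add_zero (g' a), ← LinearMap.mem_ker.1 hb, ← map_add, hab, hg', hri]
          exact LinearMap.congr_fun hfπ y
        rw [eq_top_iff]
        rintro x -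
        obtain ⟨y, hy, hyx⟩ := (h₁.trans hrange.symm).ge ⟨x, rfl⟩
        rwa [← hir x, ← hyx, hir] }
  exact ⟨Q, r.i ≫ g, ⟨n, ⟨r⟩⟩, hcover⟩

end Coyoneda

section Existence

variable {k : Type w} {A : Type u} [Field k] [Ring A] [Algebra k A] [Module.Finite k A]

open scoped ModuleCat

lemma kbProj_of_inAdd (k : Type w) [Field k] [Algebra k A] [Module.Finite k A]
    {P Q : KMod A} (hP : KbProj A P) (hQ : InAdd P Q) : KbProj A Q := by
  obtain ⟨n, ⟨e⟩⟩ := hQ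
  have := kbProj_isStableUnderRetracts k (A := A)
  exact (KbProj A).prop_of_retract e ((KbProj A).prop_of_iso (biproduct.isoProduct _).symm
    ((KbProj A).prop_product fun _ => hP))

lemma exists_isDeltaStep (k : Type w) [Field k] [Algebra k A] [Module.Finite k A]
    {P X : KMod A} (hP : KbProj A P) (hX : KbProj A X) (m : ℤ) :
    ∃ Y, IsDeltaStep P m X Y := by
  have : Module.Finite k (End P) := moduleFinite_hom_of_kbProj hP hP
  have : Module.Finite k (P ⟶ X⟦-m⟧) := moduleFinite_hom_of_kbProj hP ((KbProj A).le_shift _ _ hX)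
  obtain ⟨Q, g, hQ, hg⟩ := exists_isProjectiveCover (k := k) P (X⟦-m⟧) fun n e he => by
    obtain ⟨Q, r, -, hr⟩ := exists_retract_of_kbProj k ((KbProj A).prop_of_iso
      (biproduct.isoProduct _).symm ((KbProj A).prop_product fun _ : Fin n => hP)) e he
    exact ⟨Q, r, hr⟩
  obtain ⟨Y, h, δ, hT⟩ := distinguished_cocone_triangle
    (g⟦m⟧' ≫ (shiftFunctorCompIsoId (KMod A) (-m) m (neg_add_cancel m)).hom.app X)
  exact ⟨Y, Q, g, h, δ, hQ, hg, hT⟩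

lemma IsDeltaStep.kbProj (k : Type w) [Field k] [Algebra k A] [Module.Finite k A]
    {P X Y : KMod A} {m : ℤ} (h : IsDeltaStep P m X Y) (hP : KbProj A P)
    (hX : KbProj A X) : KbProj A Y := by
  obtain ⟨Q, g, _, _, hQ, -, hT⟩ := h
  exact (KbProj A).ext_of_isTriangulatedClosed₃ _ hT
    ((KbProj A).le_shift _ _ (kbProj_of_inAdd k hP hQ)) hX

lemma exists_isDeltaFamily (k : Type w) [Field k] [Algebra k A] [Module.Finite k A]
    {P M : KMod A} (hP : KbProj A P) (hM : KbProj A M) (s : ℤ) (r : ℕ) :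
    ∃ Δ, IsDeltaFamily P M s r Δ := by
  choose Y hY using fun (X : {X // KbProj A X}) (n : ℕ) =>
    exists_isDeltaStep k hP X.2 (n + s - r)
  -- Membership in K^b(proj A) is carried along, as it makes the next Hom group finite-dimensional.
  let Δ : ℕ → {X // KbProj A X} := fun n => Nat.rec ⟨M, hM⟩
    (fun n X => ⟨Y X n, (hY X n).kbProj k hP X.2⟩) n
  exact ⟨fun n => (Δ n).1, ⟨Iso.refl _⟩, fun n => hY (Δ n) n⟩

lemma IsDeltaFamily.kbProj (k : Type w) [Field k] [Algebra k A] [Module.Finite k A]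
    {P M : KMod A} {s : ℤ} {r : ℕ} {Δ : ℕ → KMod A}
    (hΔ : IsDeltaFamily P M s r Δ) (hP : KbProj A P) (hM : KbProj A M) (n : ℕ) :
    KbProj A (Δ n) := by
  induction n with
  | zero => exact (KbProj A).prop_of_iso hΔ.1.some.symm hM
  | succ n ih => exact (hΔ.2 n).kbProj k hP ih

end Existence

/-! ### The equivalence. -/

section Main

variable {k : Type w} {A : Type u} [Field k] [Ring A] [Algebra k A] [Module.Finite k A]
  {P : KMod A} {s : ℤ} {r : ℕ} {Δ : ℕ → KMod A}

lemma HasLengthWithTop.isZero_cohomology (hlen : HasLengthWithTop P s r) {i : ℤ}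
    (hi : i < s - r ∨ s < i) : IsZero (cohomology P i) := by
  by_contra h
  have h₁ := hlen.1.2 h
  have h₂ := hlen.2.2 h
  lia

lemma kbProj_thetaObj (k : Type w) [Field k] [Algebra k A] [Module.Finite k A]
    (hP : KbProj A P) (hΔ : IsDeltaFamily P (regularComplex A) s r Δ) (n : ℕ) :
    KbProj A (thetaObj P s r Δ n) :=
  (KbProj A).prop_of_iso (biprod.isoProd _ _).symm
    ((KbProj A).prop_prod _ _ (hΔ.kbProj k hP kbProj_regularComplex n) ((KbProj A).le_shift _ _ hP))

/-- The complexes `Θₙ` generate `K^b(proj A)`. -/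
lemma kbProj_le_triangEnvelope_thetaObj (hΔ : IsDeltaFamily P (regularComplex A) s r Δ) (n : ℕ) :
    KbProj A ≤ (ObjectProperty.singleton (thetaObj P s r Δ n)).triangEnvelope := by
  set Q := (ObjectProperty.singleton (thetaObj P s r Δ n)).triangEnvelope
  have hθ : Q (thetaObj P s r Δ n) := ObjectProperty.le_triangEnvelope _ _ (by simp)
  have hQΔ : Q (Δ n) :=
    Q.prop_of_retract ⟨biprod.inl, biprod.fst, biprod.inl_fst⟩ hθ
  have hQP : Q P := by
    have : Q (P⟦(n + s - r : ℤ)⟧) :=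
      Q.prop_of_retract ⟨biprod.inr, biprod.snd, biprod.inr_snd⟩ hθ
    exact Q.prop_of_iso ((shiftFunctorCompIsoId _ (n + s - r : ℤ) _ (add_neg_cancel _)).app P)
      (Q.le_shift (-(n + s - r : ℤ)) _ this)
  have hadd : ∀ X, InAdd P X → Q X := by
    rintro X ⟨m, ⟨e⟩⟩
    exact Q.prop_of_retract e (Q.prop_of_iso (biproduct.isoProduct _).symm
      (Q.prop_product fun _ => hQP))
  -- Walk back along the triangles from `Δ n` to `Δ 0`.
  have key : ∀ j ≤ n, Q (Δ (n - j)) := by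
    intro j
    induction j with
    | zero => exact fun _ => hQΔ
    | succ j ih =>
      intro hj
      obtain ⟨T, hT, X, hX, e₁, e₂, e₃⟩ := hΔ.exists_triangle (n - (j + 1))
      rw [← e₂]
      refine Q.ext_of_isTriangulatedClosed₂ T hT ?_ ?_
      · rw [e₁]
        exact Q.le_shift _ _ (hadd X hX)
      · rw [e₃, show n - (j + 1) + 1 = n - j by lia]
        exact ih (by lia)
  refine kbProj_le_of_regularComplex (Q.prop_of_iso hΔ.1.some ?_)
  simpa using key n le_rfl

end Main

theorem mainTheorem8 {k : Type w} {A : Type u} [Field k] [Ring A] [Algebra k A]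
    [Module.Finite k A] (hA : IsSymmetricAlg k A)
    (P : KMod A) (hP : IsPartialTilting P) (s : ℤ) (r : ℕ) (hlen : HasLengthWithTop P s r) :
    (∃ Δ : ℕ → KMod A, IsDeltaFamily P (regularComplex A) s r Δ) ∧
    ∀ Δ : ℕ → KMod A, IsDeltaFamily P (regularComplex A) s r Δ →
      ((∀ i : ℤ, 0 < i → IsZero (cohomology (Δ r) i)) ↔
        ∀ n : ℕ, r ≤ n → IsTilting (thetaObj P s r Δ n)) := by
  obtain ⟨hPK, hPo⟩ := hP
  refine ⟨exists_isDeltaFamily k hPK kbProj_regularComplex s r, fun Δ hΔ => ?_⟩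
  have hΔK := hΔ.kbProj k hPK kbProj_regularComplex
  -- Dual to Hom(A, P[-i]) = H^{-i}(P) = 0.
  have hM : ∀ i : ℤ, (i < -s ∨ r - s < i) → HomVanish P (regularComplex A) i := fun i hi => by
    have := hA.homVanish_neg kbProj_regularComplex ((homVanish_regularComplex_iff P (-i)).2
      (hlen.isZero_cohomology (by lia)))
    rwa [neg_neg] at this
  have htilt : ∀ n, r ≤ n →
      (IsTilting (thetaObj P s r Δ n) ↔ ∀ i : ℤ, 0 < i → HomVanish (Δ n) (Δ n) i) := by
    intro n hn
    have h₁ : IsTilting (thetaObj P s r Δ n) ↔ IsSelfOrthogonal (thetaObj P s r Δ n) :=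
      ⟨fun h => h.1.2, fun h =>
        ⟨⟨kbProj_thetaObj k hPK hΔ n, h⟩, kbProj_le_triangEnvelope_thetaObj hΔ n⟩⟩
    rw [h₁, isSelfOrthogonal_thetaObj_iff hPo
      (fun i hi => hΔ.homVanish_of_le hPo hM hn (by lia)) (fun i hi => ?_)]
    · refine ⟨fun h i hi => h i hi.ne', fun h i hi => ?_⟩
      -- Negative degrees follow from positive ones by duality of `Δ n` with itself.
      rcases lt_or_gt_of_ne hi with hi | hi
      · have := hA.homVanish_neg (hΔK n) (h (-i) (by lia))
        rwa [neg_neg] at this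
      · exact h i hi
    · have := hA.homVanish_neg hPK
        (hΔ.homVanish_of_le hPo hM hn (i := -(n + s - r + i)) (by lia))
      rwa [neg_neg] at this
  have hr : (∀ i : ℤ, 0 < i → IsZero (cohomology (Δ r) i)) ↔
      ∀ i : ℤ, 0 < i → HomVanish (Δ r) (Δ r) i := by
    refine forall₂_congr fun i hi => ?_
    rw [← homVanish_regularComplex_iff, hΔ.homVanish_self_iff hPo hM hi]
  rw [hr]
  refine ⟨fun h n hn => (htilt n hn).2 ?_, fun h => (htilt r le_rfl).1 (h r le_rfl)⟩
  exact hΔ.homVanish_self_of_le hPo hM (fun n i => hA.homVanish_neg hPK) h hn
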